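/- Let $d\ge 0$ be an integer, $\mathbb K$ a field, $\mathcal A$ a $\mathbb K$-algebra isomorphic to $\mathrm{Mat}_{d+1}(\mathbb K)$ (rows and columns indexed by $0,\dots,d$), $\mathrm{tr}$ the corresponding trace, and $V$ the irreducible left $\mathcal A$-module. An eigenvalue of $X\in\mathcal A$ is a root of its minimal polynomial, and $X$ is multiplicity-free if it has $d+1$ distinct eigenvalues, all in $\mathbb K$; the primitive idempotent of such an $X$ associated with its eigenvalue $\theta$ is $\prod_{\theta'\neq\theta}(X-\theta' I)/(\theta-\theta')$, the product over the other eigenvalues. Let $\Phi=(A;E_0,\dots,E_d;A^*;E^*_0,\dots,E^*_d)$ be a Leonard system in $\mathcal A$: $A,A^*\in\mathcal A$ are multiplicity-free; $E_0,\dots,E_d$ (resp. $E^*_0,\dots,E^*_d$) is an ordering of the primitive idempotents of $A$ (resp. $A^*$); and for $0\le i,j\le d$ both $E_iA^*E_j$ and $E^*_iAE^*_j$ are zero if $|i-j|>1$ and nonzero if $|i-j|=1$. Let $\theta_i$ (resp. $\theta^*_i$) be the eigenvalue of $A$ (resp. $A^*$) associated with $E_i$ (resp. $E^*_i$), and put $a_i=\mathrm{tr}(AE^*_i)$,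 $a^*_i=\mathrm{tr}(A^*E_i)$. For $1\le i\le d$ let $\varphi_i$ be the eigenvalue of $(A-\theta_{i-1}I)(A^*-\theta^*_iI)$ on the one-dimensional space $(E^*_0V+\cdots+E^*_iV)\cap(E_iV+\cdots+E_dV)$ (first split sequence), and let $\phi_1,\dots,\phi_d$ (second split sequence) be the first split sequence of the Leonard system $(A;E_d,\dots,E_0;A^*;E^*_0,\dots,E^*_d)$. Identify $S_4$ with the set of linear orderings $g=wxyz$ of the set $\Omega=\{0,d,0^*,d^*\}$ of four symbols; $0^*$ and $d^*$ are called starred. Fix nonzero vectors $\eta_0\in E_0V$, $\eta_d\in E_dV$, $\eta^*_0\in E^*_0V$, $\eta^*_d\in E^*_dV$. For $0\le n\le d$ write $$L_n=\prod_{h=0}^{n-1}(A-\theta_hI),\quad H_n=\prod_{h=n+1}^{d}(A-\theta_hI),\quad L^*_n=\prod_{h=0}^{n-1}(A^*-\theta^*_hI),\quad H^*_n=\prod_{h=n+1}^{d}(A^*-\theta^*_hI).$$ **Theorem.** For every $g\in S_4$ the vectors $v_0,\dots,v_d$ given in the tables below form a basis $[g]$ of $V$. Let $A^g$ and $A^{*g}$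 be the matrices representing $A$ and $A^*$ with respect to $[g]$, that is, $Xv_j=\sum_{i=0}^d X^g_{ij}v_i$ for $X\in\{A,A^*\}$. Their entries are as follows, where the $(i,i-1)$- and $(i-1,i)$-entries are for $1\le i\le d$, the $(i,i)$-entries are for $0\le i\le d$, and all entries not displayed are zero. Table 1. $$\begin{array}{c|c|ccc|ccc} g & v_i & A^g_{i,i-1} & A^g_{ii} & A^g_{i-1,i} & A^{*g}_{i,i-1} & A^{*g}_{ii} & A^{*g}_{i-1,i}\\ \hline d^*00^*d & L_i\eta^*_0 & 1&\theta_i&0&0&\theta^*_i&\varphi_i\\ 0d^*0^*d & H^*_i\eta_d & \varphi_i&\theta_i&0&0&\theta^*_i&1\\ d^*0d0^* & L_{d-i}\eta^*_0 & 0&\theta_{d-i}&1&\varphi_{d-i+1}&\theta^*_{d-i}&0\\ 0d^*d0^* & H^*_{d-i}\eta_d & 0&\theta_{d-i}&\varphi_{d-i+1}&1&\theta^*_{d-i}&0\\ \hline d0^*0d^* & L^*_i\eta_0 & 0&\theta_i&\varphi_i&1&\theta^*_i&0\\ 0^*d0d^* & H_i\eta^*_d & 0&\theta_i&1&\varphi_i&\theta^*_i&0\\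 d0^*d^*0 & L^*_{d-i}\eta_0 & \varphi_{d-i+1}&\theta_{d-i}&0&0&\theta^*_{d-i}&1\\ 0^*dd^*0 & H_{d-i}\eta^*_d & 1&\theta_{d-i}&0&0&\theta^*_{d-i}&\varphi_{d-i+1}\\ \hline dd^*00^* & H^*_{d-i}\eta_0 & 0&\theta_i&\phi_{d-i+1}&1&\theta^*_{d-i}&0\\ d^*d00^* & H_i\eta^*_0 & 0&\theta_i&1&\phi_{d-i+1}&\theta^*_{d-i}&0\\ dd^*0^*0 & H^*_i\eta_0 & \phi_i&\theta_{d-i}&0&0&\theta^*_i&1\\ d^*d0^*0 & H_{d-i}\eta^*_0 & 1&\theta_{d-i}&0&0&\theta^*_i&\phi_i\\ \hline 00^*dd^* & L^*_i\eta_d & 0&\theta_{d-i}&\phi_i&1&\theta^*_i&0\\ 0^*0dd^* & L_{d-i}\eta^*_d & 0&\theta_{d-i}&1&\phi_i&\theta^*_i&0\\ 00^*d^*d & L^*_{d-i}\eta_d & \phi_{d-i+1}&\theta_i&0&0&\theta^*_{d-i}&1\\ 0^*0d^*d & L_i\eta^*_d & 1&\theta_i&0&0&\theta^*_{d-i}&\phi_{d-i+1}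 \end{array}$$ For Tables 2 and 3 write $\beta_i=\prod_{h=0}^{i-1}(\theta_i-\theta_h)$, $\alpha_i=\prod_{h=i+1}^{d}(\theta_i-\theta_h)$, $\beta^*_i=\prod_{h=0}^{i-1}(\theta^*_i-\theta^*_h)$, $\alpha^*_i=\prod_{h=i+1}^{d}(\theta^*_i-\theta^*_h)$. Table 2 ($A^g$ diagonal). $$\begin{array}{c|c|c|ccc} g & v_i & A^g_{ii} & A^{*g}_{i,i-1} & A^{*g}_{ii} & A^{*g}_{i-1,i}\\ \hline d^*0^*0d & E_i\eta^*_0 & \theta_i & \phi_{d-i+1}\,\alpha_i/\alpha_{i-1} & a^*_i & \varphi_i\,\beta_{i-1}/\beta_i\\ 0^*d^*0d & E_i\eta^*_d & \theta_i & \varphi_i\,\alpha_i/\alpha_{i-1} & a^*_i & \phi_{d-i+1}\,\beta_{i-1}/\beta_i\\ d^*0^*d0 & E_{d-i}\eta^*_0 & \theta_{d-i} & \varphi_{d-i+1}\,\beta_{d-i}/\beta_{d-i+1} & a^*_{d-i} & \phi_i\,\alpha_{d-i+1}/\alpha_{d-i}\\ 0^*d^*d0 & E_{d-i}\eta^*_d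 & \theta_{d-i} & \phi_i\,\beta_{d-i}/\beta_{d-i+1} & a^*_{d-i} & \varphi_{d-i+1}\,\alpha_{d-i+1}/\alpha_{d-i} \end{array}$$ Table 3 ($A^{*g}$ diagonal). $$\begin{array}{c|c|ccc|c} g & v_i & A^g_{i,i-1} & A^g_{ii} & A^g_{i-1,i} & A^{*g}_{ii}\\ \hline d00^*d^* & E^*_i\eta_0 & \phi_i\,\alpha^*_i/\alpha^*_{i-1} & a_i & \varphi_i\,\beta^*_{i-1}/\beta^*_i & \theta^*_i\\ 0d0^*d^* & E^*_i\eta_d & \varphi_i\,\alpha^*_i/\alpha^*_{i-1} & a_i & \phi_i\,\beta^*_{i-1}/\beta^*_i & \theta^*_i\\ d0d^*0^* & E^*_{d-i}\eta_0 & \varphi_{d-i+1}\,\beta^*_{d-i}/\beta^*_{d-i+1} & a_{d-i} & \phi_{d-i+1}\,\alpha^*_{d-i+1}/\alpha^*_{d-i} & \theta^*_{d-i}\\ 0dd^*0^* & E^*_{d-i}\eta_d & \phi_{d-i+1}\,\beta^*_{d-i}/\beta^*_{d-i+1} & a_{d-i} & \varphi_{d-i+1}\,\alpha^*_{d-i+1}/\alpha^*_{d-i}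 & \theta^*_{d-i} \end{array}$$ Moreover, writing $g=wxyz$: if neither $y$ nor $z$ is starred, $A^g$ is diagonal and $A^{*g}$ is irreducible tridiagonal; if only $y$ is starred, $A^g$ is lower bidiagonal and $A^{*g}$ is upper bidiagonal; if only $z$ is starred, $A^g$ is upper bidiagonal and $A^{*g}$ is lower bidiagonal; if both are starred, $A^g$ is irreducible tridiagonal and $A^{*g}$ is diagonal. Here a tridiagonal matrix is irreducible if all entries immediately above and below the main diagonal are nonzero, and a matrix is lower (upper) bidiagonal if all its nonzero entries lie on or immediately below (above) the main diagonal. -/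

import Mathlib

noncomputable section

open Polynomial

/-- The set `Ω` of the four symbols `0, d, 0*, d*` (in this order). An element `wxyz` of `S₄`,
that is, a linear ordering of `Ω`, is an equivalence `g : Fin 4 ≃ Omega4` with
`w = g 0`, `x = g 1`, `y = g 2`, `z = g 3`. -/
inductive Omega4 : Type
  | z0
  | zd
  | s0
  | sd
  deriving DecidableEq

/-- The symbols `0*` and `d*` are starred, the symbols `0` and `d` are not. -/
def Omega4.Starred (w : Omega4) : Prop := w = Omega4.s0 ∨ w = Omega4.sd

/-- A sequence `f₀, …, f_d`, read at natural numbers (and `0` beyond `d`). -/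
def seqNat {M : Type*} [Zero M] {d : ℕ} (f : Fin (d + 1) → M) (n : ℕ) : M :=
  if h : n < d + 1 then f ⟨n, h⟩ else 0

/-- `A` is multiplicity-free, `θ₀, …, θ_d` is an ordering of its eigenvalues (the roots of its
minimal polynomial, which all lie in `K`), and `Eᵢ = ∏_{j ≠ i} (A - θⱼ) / (θᵢ - θⱼ)` is the
primitive idempotent of `A` associated with `θᵢ`. -/
structure IsPrimitiveIdempotents {K 𝒜 : Type*} [Field K] [Ring 𝒜] [Algebra K 𝒜] {d : ℕ}
    (A : 𝒜) (θ : Fin (d + 1) → K) (E : Fin (d + 1) → 𝒜) : Prop where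
  splits : (minpoly K A).Splits
  isRoot_iff : ∀ x : K, (minpoly K A).IsRoot x ↔ ∃ i, θ i = x
  injective : Function.Injective θ
  E_eq : ∀ i, E i = aeval A (∏ j ∈ Finset.univ.erase i, (C (θ i - θ j)⁻¹ * (X - C (θ j))))

theorem IsPrimitiveIdempotents.rev {K 𝒜 : Type*} [Field K] [Ring 𝒜] [Algebra K 𝒜] {d : ℕ}
    {A : 𝒜} {θ : Fin (d + 1) → K} {E : Fin (d + 1) → 𝒜} (h : IsPrimitiveIdempotents A θ E) :
    IsPrimitiveIdempotents A (fun i => θ i.rev) (fun i => E i.rev) where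
  splits := h.splits
  isRoot_iff x := by
    rw [h.isRoot_iff]
    exact ⟨fun ⟨i, hi⟩ => ⟨i.rev, by simpa using hi⟩, fun ⟨i, hi⟩ => ⟨i.rev, hi⟩⟩
  injective := h.injective.comp Fin.rev_injective
  E_eq i := by
    rw [h.E_eq]
    congr 1
    refine Finset.prod_bij' (fun j _ => j.rev) (fun j _ => j.rev) ?_ ?_ ?_ ?_ ?_
    · intro j hj
      simp only [Finset.mem_erase, Finset.mem_univ, and_true] at hj ⊢
      exact fun e => hj (by rw [← e, Fin.rev_rev])
    · intro j hj
      simp only [Finset.mem_erase, Finset.mem_univ, and_true] at hj ⊢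
      exact fun e => hj (Fin.rev_injective e)
    · simp
    · simp
    · simp

/-- A Leonard system `(A; E₀, …, E_d; A*; E*₀, …, E*_d)` of diameter `d` in the `K`-algebra `𝒜`
(which is to be isomorphic to `Mat_{d+1}(K)`). The star is written `s`. The eigenvalue `θᵢ` of `A`
associated with `Eᵢ`, and the eigenvalue `θ*ᵢ` of `A*` associated with `E*ᵢ`, are carried along;
they are determined by the rest. -/
structure LeonardSystem (K 𝒜 : Type*) [Field K] [Ring 𝒜] [Algebra K 𝒜] (d : ℕ) where
  A : 𝒜
  E : Fin (d + 1) → 𝒜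
  As : 𝒜
  Es : Fin (d + 1) → 𝒜
  θ : Fin (d + 1) → K
  θs : Fin (d + 1) → K
  primA : IsPrimitiveIdempotents A θ E
  primAs : IsPrimitiveIdempotents As θs Es
  E_far : ∀ i j : Fin (d + 1), 1 < |(i : ℤ) - (j : ℤ)| → E i * As * E j = 0
  E_near : ∀ i j : Fin (d + 1), |(i : ℤ) - (j : ℤ)| = 1 → E i * As * E j ≠ 0
  Es_far : ∀ i j : Fin (d + 1), 1 < |(i : ℤ) - (j : ℤ)| → Es i * A * Es j = 0
  Es_near : ∀ i j : Fin (d + 1), |(i : ℤ) - (j : ℤ)| = 1 → Es i * A * Es j ≠ 0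

theorem abs_rev_sub_rev {d : ℕ} (i j : Fin (d + 1)) :
    |((i.rev : Fin (d + 1)) : ℤ) - ((j.rev : Fin (d + 1)) : ℤ)| = |(i : ℤ) - (j : ℤ)| := by
  have hi : ((i.rev : Fin (d + 1)) : ℤ) = d - i := by
    have h1 := Fin.val_rev i
    have h2 := i.isLt
    omega
  have hj : ((j.rev : Fin (d + 1)) : ℤ) = d - j := by
    have h1 := Fin.val_rev j
    have h2 := j.isLt
    omega
  rw [hi, hj, abs_sub_comm]
  congr 1
  ring

/-- The matrix in `Mat_{d+1}(K)`, with rows and columns indexed by `0, …, d`, that has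
`(i, i-1)`-entry `lo i` and `(i-1, i)`-entry `up i` for `1 ≤ i ≤ d`, `(i, i)`-entry `di i` for
`0 ≤ i ≤ d`, and all other entries zero. -/
def triMat {K : Type*} [Zero K] {d : ℕ} (lo di up : ℕ → K) :
    Matrix (Fin (d + 1)) (Fin (d + 1)) K :=
  Matrix.of fun i j =>
    if (i : ℕ) = (j : ℕ) + 1 then lo i
    else if (i : ℕ) = (j : ℕ) then di i
    else if (j : ℕ) = (i : ℕ) + 1 then up j
    else 0

/-- Tridiagonal, with all entries immediately above and below the main diagonal nonzero. -/
def IsIrredTridiagonal {K : Type*} [Zero K] {d : ℕ}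
    (M : Matrix (Fin (d + 1)) (Fin (d + 1)) K) : Prop :=
  ∀ i j : Fin (d + 1), (1 < |(i : ℤ) - (j : ℤ)| → M i j = 0) ∧
    (|(i : ℤ) - (j : ℤ)| = 1 → M i j ≠ 0)

/-- Nonzero entries occur only on the main diagonal or immediately below it. -/
def IsLowerBidiagonal {K : Type*} [Zero K] {d : ℕ}
    (M : Matrix (Fin (d + 1)) (Fin (d + 1)) K) : Prop :=
  ∀ i j : Fin (d + 1), M i j ≠ 0 → (i : ℕ) = (j : ℕ) ∨ (i : ℕ) = (j : ℕ) + 1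

/-- Nonzero entries occur only on the main diagonal or immediately above it. -/
def IsUpperBidiagonal {K : Type*} [Zero K] {d : ℕ}
    (M : Matrix (Fin (d + 1)) (Fin (d + 1)) K) : Prop :=
  ∀ i j : Fin (d + 1), M i j ≠ 0 → (i : ℕ) = (j : ℕ) ∨ (j : ℕ) = (i : ℕ) + 1

/-- `(tᵢ - t₀)(tᵢ - t₁) ⋯ (tᵢ - tᵢ₋₁)`. -/
def prodBelow {K : Type*} [Field K] (t : ℕ → K) (i : ℕ) : K :=
  ∏ h ∈ Finset.range i, (t i - t h)

/-- `(tᵢ - t_d)(tᵢ - t_{d-1}) ⋯ (tᵢ - tᵢ₊₁)`. -/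
def prodAbove {K : Type*} [Field K] (d : ℕ) (t : ℕ → K) (i : ℕ) : K :=
  ∏ h ∈ Finset.Ioc i d, (t i - t h)

namespace LeonardSystem

variable {K 𝒜 : Type*} [Field K] [Ring 𝒜] [Algebra K 𝒜] {d : ℕ}

/-- The second inversion `(A; E_d, …, E₀; A*; E*₀, …, E*_d)` of `Φ`. -/
def secondInversion (Φ : LeonardSystem K 𝒜 d) : LeonardSystem K 𝒜 d where
  A := Φ.A
  E := fun i => Φ.E i.rev
  As := Φ.As
  Es := Φ.Es
  θ := fun i => Φ.θ i.rev
  θs := Φ.θs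
  primA := Φ.primA.rev
  primAs := Φ.primAs
  E_far i j h := Φ.E_far _ _ (by rw [abs_rev_sub_rev]; exact h)
  E_near i j h := Φ.E_near _ _ (by rw [abs_rev_sub_rev]; exact h)
  Es_far := Φ.Es_far
  Es_near := Φ.Es_near

section Module

variable (Φ : LeonardSystem K 𝒜 d) (V : Type*) [AddCommGroup V] [Module K V] [Module 𝒜 V]
  [IsScalarTower K 𝒜 V]

/-- The subspace `X V` of `V`, for `X` in `𝒜`. -/
def image (X : 𝒜) : Submodule K V := LinearMap.range (Algebra.lsmul K K V X)

/-- `Uᵢ = (E*₀V + ⋯ + E*ᵢV) ∩ (EᵢV + ⋯ + E_dV)`. -/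
def splitSpace (i : ℕ) : Submodule K V :=
  (⨆ j : Fin (d + 1), ⨆ _ : (j : ℕ) ≤ i, image V (Φ.Es j)) ⊓
    (⨆ j : Fin (d + 1), ⨆ _ : i ≤ (j : ℕ), image V (Φ.E j))

/-- The first split sequence: for `1 ≤ i ≤ d`, `φᵢ` is the eigenvalue of
`(A - θᵢ₋₁)(A* - θ*ᵢ)` on the (one-dimensional) space `Uᵢ`; `φ₀ = φ_{d+1} = 0`. -/
def firstSplit (i : ℕ) : K :=
  if 1 ≤ i ∧ i ≤ d then
    Classical.epsilon fun c : K => ∀ u ∈ Φ.splitSpace V i,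
      ((Φ.A - algebraMap K 𝒜 (seqNat Φ.θ (i - 1))) *
        (Φ.As - algebraMap K 𝒜 (seqNat Φ.θs i))) • u = c • u
  else 0

/-- The second split sequence: the first split sequence of the second inversion. -/
def secondSplit (i : ℕ) : K := Φ.secondInversion.firstSplit V i

end Module

/-- `(A - θ₀)(A - θ₁) ⋯ (A - θₙ₋₁)`. -/
def fromLow (A : 𝒜) (θ : Fin (d + 1) → K) (n : ℕ) : 𝒜 :=
  aeval A (∏ h ∈ Finset.range n, (X - C (seqNat θ h)))

/-- `(A - θ_d)(A - θ_{d-1}) ⋯ (A - θₙ₊₁)`. -/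
def fromHigh (A : 𝒜) (θ : Fin (d + 1) → K) (n : ℕ) : 𝒜 :=
  aeval A (∏ h ∈ Finset.Ioc n d, (X - C (seqNat θ h)))

/-- The vector `vᵢ` of the basis `[wxyz]` of `V`, built from the vectors
`η₀ = η z0`, `η_d = η zd`, `η*₀ = η s0`, `η*_d = η sd`. (The value is only used when `w, x, y, z`
are distinct.) -/
def basisVec (Φ : LeonardSystem K 𝒜 d) {V : Type*} [AddCommGroup V] [Module 𝒜 V]
    (η : Omega4 → V) (w x y z : Omega4) (i : ℕ) : V :=
  match w, x, y, z with
  | .sd, .z0, .s0, .zd => fromLow Φ.A Φ.θ i • η .s0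
  | .z0, .sd, .s0, .zd => fromHigh Φ.As Φ.θs i • η .zd
  | .sd, .z0, .zd, .s0 => fromLow Φ.A Φ.θ (d - i) • η .s0
  | .z0, .sd, .zd, .s0 => fromHigh Φ.As Φ.θs (d - i) • η .zd
  | .zd, .s0, .z0, .sd => fromLow Φ.As Φ.θs i • η .z0
  | .s0, .zd, .z0, .sd => fromHigh Φ.A Φ.θ i • η .sd
  | .zd, .s0, .sd, .z0 => fromLow Φ.As Φ.θs (d - i) • η .z0
  | .s0, .zd, .sd, .z0 => fromHigh Φ.A Φ.θ (d - i) • η .sd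
  | .zd, .sd, .z0, .s0 => fromHigh Φ.As Φ.θs (d - i) • η .z0
  | .sd, .zd, .z0, .s0 => fromHigh Φ.A Φ.θ i • η .s0
  | .zd, .sd, .s0, .z0 => fromHigh Φ.As Φ.θs i • η .z0
  | .sd, .zd, .s0, .z0 => fromHigh Φ.A Φ.θ (d - i) • η .s0
  | .z0, .s0, .zd, .sd => fromLow Φ.As Φ.θs i • η .zd
  | .s0, .z0, .zd, .sd => fromLow Φ.A Φ.θ (d - i) • η .sd
  | .z0, .s0, .sd, .zd => fromLow Φ.As Φ.θs (d - i) • η .zd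
  | .s0, .z0, .sd, .zd => fromLow Φ.A Φ.θ i • η .sd
  | .sd, .s0, .z0, .zd => seqNat Φ.E i • η .s0
  | .s0, .sd, .z0, .zd => seqNat Φ.E i • η .sd
  | .sd, .s0, .zd, .z0 => seqNat Φ.E (d - i) • η .s0
  | .s0, .sd, .zd, .z0 => seqNat Φ.E (d - i) • η .sd
  | .zd, .z0, .s0, .sd => seqNat Φ.Es i • η .z0
  | .z0, .zd, .s0, .sd => seqNat Φ.Es i • η .zd
  | .zd, .z0, .sd, .s0 => seqNat Φ.Es (d - i) • η .z0
  | .z0, .zd, .sd, .s0 => seqNat Φ.Es (d - i) • η .zd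
  | _, _, _, _ => 0

/-- `aᵢ = tr A E*ᵢ`, the trace being that of `Mat_{d+1}(K)`, to which `𝒜` is isomorphic by `σ`. -/
def a (Φ : LeonardSystem K 𝒜 d) (σ : 𝒜 ≃ₐ[K] Matrix (Fin (d + 1)) (Fin (d + 1)) K)
    (i : ℕ) : K := (σ (Φ.A * seqNat Φ.Es i)).trace

/-- `a*ᵢ = tr A* Eᵢ`. -/
def as (Φ : LeonardSystem K 𝒜 d) (σ : 𝒜 ≃ₐ[K] Matrix (Fin (d + 1)) (Fin (d + 1)) K)
    (i : ℕ) : K := (σ (Φ.As * seqNat Φ.E i)).trace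

/-- The table of the matrices: for `g = wxyz` the pair `(A^g, A*^g)` in terms of sequences `θ`,
`θs`, `a`, `as`, `φ`, `ψ` (`φ` is the first and `ψ` the second split sequence). Each matrix is
`triMat` of its `(i, i-1)`-, `(i, i)`- and `(i-1, i)`-entries. (The value is only used when
`w, x, y, z` are distinct.) -/
def matrixTable (d : ℕ) (θ θs a as φ ψ : ℕ → K) (w x y z : Omega4) :
    Matrix (Fin (d + 1)) (Fin (d + 1)) K × Matrix (Fin (d + 1)) (Fin (d + 1)) K :=
  match w, x, y, z with
  | .sd, .z0, .s0, .zd => (triMat 1 θ 0, triMat 0 θs φ)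
  | .z0, .sd, .s0, .zd => (triMat φ θ 0, triMat 0 θs 1)
  | .sd, .z0, .zd, .s0 =>
    (triMat 0 (fun i => θ (d - i)) 1, triMat (fun i => φ (d - i + 1)) (fun i => θs (d - i)) 0)
  | .z0, .sd, .zd, .s0 =>
    (triMat 0 (fun i => θ (d - i)) (fun i => φ (d - i + 1)), triMat 1 (fun i => θs (d - i)) 0)
  | .zd, .s0, .z0, .sd => (triMat 0 θ φ, triMat 1 θs 0)
  | .s0, .zd, .z0, .sd => (triMat 0 θ 1, triMat φ θs 0)
  | .zd, .s0, .sd, .z0 =>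
    (triMat (fun i => φ (d - i + 1)) (fun i => θ (d - i)) 0, triMat 0 (fun i => θs (d - i)) 1)
  | .s0, .zd, .sd, .z0 =>
    (triMat 1 (fun i => θ (d - i)) 0, triMat 0 (fun i => θs (d - i)) (fun i => φ (d - i + 1)))
  | .zd, .sd, .z0, .s0 =>
    (triMat 0 θ (fun i => ψ (d - i + 1)), triMat 1 (fun i => θs (d - i)) 0)
  | .sd, .zd, .z0, .s0 =>
    (triMat 0 θ 1, triMat (fun i => ψ (d - i + 1)) (fun i => θs (d - i)) 0)
  | .zd, .sd, .s0, .z0 => (triMat ψ (fun i => θ (d - i)) 0, triMat 0 θs 1)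
  | .sd, .zd, .s0, .z0 => (triMat 1 (fun i => θ (d - i)) 0, triMat 0 θs ψ)
  | .z0, .s0, .zd, .sd => (triMat 0 (fun i => θ (d - i)) ψ, triMat 1 θs 0)
  | .s0, .z0, .zd, .sd => (triMat 0 (fun i => θ (d - i)) 1, triMat ψ θs 0)
  | .z0, .s0, .sd, .zd =>
    (triMat (fun i => ψ (d - i + 1)) θ 0, triMat 0 (fun i => θs (d - i)) 1)
  | .s0, .z0, .sd, .zd =>
    (triMat 1 θ 0, triMat 0 (fun i => θs (d - i)) (fun i => ψ (d - i + 1)))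
  | .sd, .s0, .z0, .zd =>
    (triMat 0 θ 0,
      triMat (fun i => ψ (d - i + 1) * (prodAbove d θ i / prodAbove d θ (i - 1)))
        as
        (fun i => φ i * (prodBelow θ (i - 1) / prodBelow θ i)))
  | .s0, .sd, .z0, .zd =>
    (triMat 0 θ 0,
      triMat (fun i => φ i * (prodAbove d θ i / prodAbove d θ (i - 1)))
        as
        (fun i => ψ (d - i + 1) * (prodBelow θ (i - 1) / prodBelow θ i)))
  | .sd, .s0, .zd, .z0 =>
    (triMat 0 (fun i => θ (d - i)) 0,
      triMat (fun i => φ (d - i + 1) * (prodBelow θ (d - i) / prodBelow θ (d - i + 1)))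
        (fun i => as (d - i))
        (fun i => ψ i * (prodAbove d θ (d - i + 1) / prodAbove d θ (d - i))))
  | .s0, .sd, .zd, .z0 =>
    (triMat 0 (fun i => θ (d - i)) 0,
      triMat (fun i => ψ i * (prodBelow θ (d - i) / prodBelow θ (d - i + 1)))
        (fun i => as (d - i))
        (fun i => φ (d - i + 1) * (prodAbove d θ (d - i + 1) / prodAbove d θ (d - i))))
  | .zd, .z0, .s0, .sd =>
    (triMat (fun i => ψ i * (prodAbove d θs i / prodAbove d θs (i - 1)))
        a
        (fun i => φ i * (prodBelow θs (i - 1) / prodBelow θs i)),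
      triMat 0 θs 0)
  | .z0, .zd, .s0, .sd =>
    (triMat (fun i => φ i * (prodAbove d θs i / prodAbove d θs (i - 1)))
        a
        (fun i => ψ i * (prodBelow θs (i - 1) / prodBelow θs i)),
      triMat 0 θs 0)
  | .zd, .z0, .sd, .s0 =>
    (triMat (fun i => φ (d - i + 1) * (prodBelow θs (d - i) / prodBelow θs (d - i + 1)))
        (fun i => a (d - i))
        (fun i => ψ (d - i + 1) * (prodAbove d θs (d - i + 1) / prodAbove d θs (d - i))),
      triMat 0 (fun i => θs (d - i)) 0)
  | .z0, .zd, .sd, .s0 =>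
    (triMat (fun i => ψ (d - i + 1) * (prodBelow θs (d - i) / prodBelow θs (d - i + 1)))
        (fun i => a (d - i))
        (fun i => φ (d - i + 1) * (prodAbove d θs (d - i + 1) / prodAbove d θs (d - i))),
      triMat 0 (fun i => θs (d - i)) 0)
  | _, _, _, _ => (0, 0)

end LeonardSystem

end

/-!
Let `η*₀` span `E*₀V`. Since `A` is irreducible tridiagonal on an eigenbasis of `A*`, the vectors
`(A - θ₀) ⋯ (A - θᵢ₋₁) η*₀` form a basis of `V`; on it `A` is lower and `A*` upper bidiagonal, and
the superdiagonal of `A*` is the first split sequence. Comparing it with the basis `Eᵢη*₀` gives the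
tridiagonal matrix of `A*` on the latter.

Taking duals of Leonard systems and reversing the order of the `Eᵢ` generate a dihedral group of
order 8, which acts freely on the 24 orderings of `Ω`, with orbits represented by `d*00*d`, its
reverse `d*0d0*`, and `d*0*0d`. The tables are equivariant because `A` and `A*` are self-adjoint
for a common nondegenerate bilinear form: passing to dual bases transposes their matrices, and this
relates the split sequences of a Leonard system to those of its relatives.
-/

noncomputable section

open Polynomial

section TriMat

variable {K : Type*} [Zero K] {d : ℕ}

theorem triMat_congr {lo di up lo' di' up' : ℕ → K}
    (hlo : ∀ i, 1 ≤ i → i ≤ d → lo i = lo' i) (hdi : ∀ i ≤ d, di i = di' i)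
    (hup : ∀ i, 1 ≤ i → i ≤ d → up i = up' i) :
    (triMat lo di up : Matrix (Fin (d + 1)) (Fin (d + 1)) K) = triMat lo' di' up' := by
  ext i j
  simp only [triMat, Matrix.of_apply]
  split_ifs
  · exact hlo _ (by omega) (by omega)
  · exact hdi _ (by omega)
  · exact hup _ (by omega) (by omega)
  · rfl

theorem triMat_transpose (lo di up : ℕ → K) :
    (triMat lo di up : Matrix (Fin (d + 1)) (Fin (d + 1)) K).transpose = triMat up di lo := by
  ext i j
  simp only [triMat, Matrix.transpose_apply, Matrix.of_apply]
  split_ifs <;> first | omega | congr 1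

theorem triMat_submatrix_rev (lo di up : ℕ → K) :
    (triMat lo di up : Matrix (Fin (d + 1)) (Fin (d + 1)) K).submatrix Fin.rev Fin.rev =
      triMat (fun i => up (d - i + 1)) (fun i => di (d - i)) (fun i => lo (d - i + 1)) := by
  ext i j
  simp only [triMat, Matrix.submatrix_apply, Matrix.of_apply, Fin.val_rev]
  split_ifs <;> first | omega | rfl | (congr 1; omega)

theorem exists_eq_triMat_zero {M : Matrix (Fin (d + 1)) (Fin (d + 1)) K} {di : ℕ → K}
    (hdi : ∀ i : Fin (d + 1), M i i = di i)
    (hM : ∀ i j : Fin (d + 1), i ≠ j → (i : ℕ) + 1 ≠ j → M i j = 0) :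
    ∃ up, M = triMat 0 di up := by
  refine ⟨fun n => if h : n < d + 1 then M ⟨n - 1, by omega⟩ ⟨n, h⟩ else 0, ?_⟩
  ext i j
  simp only [triMat, Matrix.of_apply, Pi.zero_apply, dif_pos j.2]
  split_ifs with hlo heq hup
  · exact hM i j (by rintro rfl; omega) (by omega)
  · rw [← Fin.ext heq, hdi]
  · congr 1
    exact Fin.ext (Nat.eq_sub_of_add_eq hup.symm)
  · exact hM i j (fun h => heq (congr_arg _ h)) (Ne.symm hup)

theorem isDiag_triMat (di : ℕ → K) :
    (triMat 0 di 0 : Matrix (Fin (d + 1)) (Fin (d + 1)) K).IsDiag := by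
  intro i j hij
  have := Fin.val_ne_iff.2 hij
  simp [triMat, this]

theorem isLowerBidiagonal_triMat (lo di : ℕ → K) :
    IsLowerBidiagonal (triMat lo di 0 : Matrix (Fin (d + 1)) (Fin (d + 1)) K) := by
  intro i j hij
  by_contra! h
  simp [triMat, h] at hij

theorem isUpperBidiagonal_triMat (di up : ℕ → K) :
    IsUpperBidiagonal (triMat 0 di up : Matrix (Fin (d + 1)) (Fin (d + 1)) K) := by
  intro i j hij
  by_contra! h
  simp [triMat, h] at hij

end TriMat

namespace IsIrredTridiagonal

variable {K : Type*} {d : ℕ} {M : Matrix (Fin (d + 1)) (Fin (d + 1)) K}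

theorem mulVec_apply_eq [NonUnitalNonAssocSemiring K] (hM : IsIrredTridiagonal M)
    {c : Fin (d + 1) → K} {k m : Fin (d + 1)}
    (hc : ∀ l, l ≠ m → |(k : ℤ) - (l : ℤ)| ≤ 1 → c l = 0) :
    M.mulVec c k = M k m * c m := by
  refine Fintype.sum_eq_single m fun l hlm => ?_
  change M k l * c l = 0
  rcases le_or_gt |(k : ℤ) - (l : ℤ)| 1 with hkl | hkl
  · rw [hc l hlm hkl, mul_zero]
  · rw [(hM k l).1 hkl, zero_mul]

variable [Field K]

theorem exists_symmetrizer (hM : IsIrredTridiagonal M) :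
    ∃ k : Fin (d + 1) → K, (∀ i, k i ≠ 0) ∧ ∀ i j, k i * M i j = k j * M j i := by
  let r : ℕ → K := fun n => if h : n < d then
    M ⟨n, by omega⟩ ⟨n + 1, by omega⟩ / M ⟨n + 1, by omega⟩ ⟨n, by omega⟩ else 1
  have r_ne_zero (n : ℕ) : r n ≠ 0 := by
    by_cases h : n < d
    · simp only [r, h, dif_pos]
      exact div_ne_zero ((hM _ _).2 (by simp)) ((hM _ _).2 (by simp))
    · simp [r, h]
  have adjacent (i j : Fin (d + 1)) (hij : (i : ℕ) = j + 1) :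
      (∏ h ∈ Finset.range i, r h) * M i j = (∏ h ∈ Finset.range j, r h) * M j i := by
    obtain ⟨i, hi⟩ := i
    obtain rfl : i = j + 1 := hij
    have hj : (j : ℕ) < d := by omega
    rw [Finset.prod_range_succ, mul_assoc]
    congr 1
    simp only [r, hj, dif_pos, Fin.eta]
    exact div_mul_cancel₀ _ ((hM _ _).2 (by simp))
  refine ⟨fun i => ∏ h ∈ Finset.range i, r h,
    fun i => Finset.prod_ne_zero_iff.2 fun h _ => r_ne_zero h, fun i j => ?_⟩
  by_cases hij : i = j
  · rw [hij]
  by_cases hlo : (i : ℕ) = j + 1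
  · exact adjacent i j hlo
  by_cases hup : (j : ℕ) = i + 1
  · exact (adjacent j i hup).symm
  rw [(hM i j).1 (by rw [lt_abs]; omega), (hM j i).1 (by rw [lt_abs]; omega), mul_zero, mul_zero]

end IsIrredTridiagonal

section MatrixRep

variable {K 𝒜 V ι : Type*} [Field K] [Ring 𝒜] [Algebra K 𝒜] [AddCommGroup V] [Module K V]
  [Module 𝒜 V] [IsScalarTower K 𝒜 V] [Fintype ι] [DecidableEq ι]

/-- The matrix representing the action of `X ∈ 𝒜` on `V` with respect to the basis `b`, that is,
`X bⱼ = ∑ᵢ (matrixRep b X)ᵢⱼ bᵢ`. -/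
def matrixRep (b : Module.Basis ι K V) (X : 𝒜) : Matrix ι ι K :=
  LinearMap.toMatrix b b (Algebra.lsmul K K V X)

theorem matrixRep_apply (b : Module.Basis ι K V) (X : 𝒜) (i j : ι) :
    matrixRep b X i j = b.repr (X • b j) i :=
  LinearMap.toMatrix_apply ..

theorem repr_smul_eq_mulVec (b : Module.Basis ι K V) (X : 𝒜) (x : V) :
    ⇑(b.repr (X • x)) = (matrixRep b X).mulVec (b.repr x) :=
  (LinearMap.toMatrix_mulVec_repr b b (Algebra.lsmul K K V X) x).symm

theorem smul_basis_eq_sum (b : Module.Basis ι K V) (X : 𝒜) (j : ι) :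
    X • b j = ∑ i, matrixRep b X i j • b i := by
  simp only [matrixRep_apply, b.sum_repr]

theorem matrixRep_unitsSMul (b : Module.Basis ι K V) (c : ι → Kˣ) (X : 𝒜) (i j : ι) :
    matrixRep (b.unitsSMul c) X i j = (c i : K)⁻¹ * matrixRep b X i j * c j := by
  rw [matrixRep_apply, matrixRep_apply, Module.Basis.repr_unitsSMul,
    Module.Basis.unitsSMul_apply, Units.smul_def, Units.smul_def, smul_algebra_smul_comm, map_smul,
    Finsupp.smul_apply, smul_eq_mul, smul_eq_mul, Units.val_inv_eq_inv_val]
  ring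

theorem matrixRep_reindex_rev {d : ℕ} (b : Module.Basis (Fin (d + 1)) K V) (X : 𝒜) :
    matrixRep (b.reindex Fin.revPerm) X = (matrixRep b X).submatrix Fin.rev Fin.rev := by
  ext i j
  simp [matrixRep_apply]

theorem matrixRep_dualBasis (Q : LinearMap.BilinForm K V) (hQ : Q.Nondegenerate)
    (b : Module.Basis ι K V) {X : 𝒜} (hX : ∀ x y, Q (X • x) y = Q x (X • y)) :
    matrixRep (Q.dualBasis hQ b) X = (matrixRep b X).transpose := by
  ext i j
  rw [matrixRep_apply, LinearMap.BilinForm.dualBasis_repr_apply, hX, smul_basis_eq_sum, map_sum]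
  simp [LinearMap.BilinForm.apply_dualBasis_left]

theorem toBilin_diagonal_smul_comm {f : Module.Basis ι K V} {k : ι → K} {X : 𝒜}
    (hX : ∀ i j, k i * matrixRep f X i j = k j * matrixRep f X j i) (x y : V) :
    Matrix.toBilin f (Matrix.diagonal k) (X • x) y =
      Matrix.toBilin f (Matrix.diagonal k) x (X • y) := by
  have hadj : Matrix.IsAdjointPair (Matrix.diagonal k) (Matrix.diagonal k)
      (matrixRep f X) (matrixRep f X) := by
    ext i j
    rw [Matrix.mul_diagonal, Matrix.diagonal_mul, hX, Matrix.transpose_apply, mul_comm]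
  have := (isAdjointPair_toLinearMap₂ f f (Matrix.diagonal k) (Matrix.diagonal k) _ _).2 hadj x y
  rw [matrixRep, Matrix.toLin_toMatrix] at this
  exact this

end MatrixRep

/-- The change of coordinates between `f` and `b` and its inverse are block triangular together. -/
theorem repr_eq_zero_iff_of_blockTriangular {K V ι : Type*} [Field K] [AddCommGroup V]
    [Module K V] [Finite ι] (f b : Module.Basis ι K V) {p : ι → Prop}
    (hp : ∀ i j, p i → ¬ p j → f.repr (b j) i = 0) (x : V) :
    (∀ i, p i → f.repr x i = 0) ↔ ∀ i, p i → b.repr x i = 0 := by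
  classical
  cases nonempty_fintype ι
  have forward {f b : Module.Basis ι K V} (hp : (f.toMatrix b).BlockTriangular p)
      (hx : ∀ i, p i → b.repr x i = 0) (i : ι) (hi : p i) : f.repr x i = 0 := by
    rw [← Module.Basis.toMatrix_mulVec_repr b f x, Matrix.mulVec, dotProduct]
    refine Finset.sum_eq_zero fun j _ => ?_
    by_cases hj : p j
    · rw [hx j hj, mul_zero]
    · rw [hp (lt_iff_le_not_ge.2 ⟨fun h => absurd h hj, fun h => hj (h hi)⟩), zero_mul]
  have hfb : (f.toMatrix b).BlockTriangular p := fun i j hij =>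
    have h := lt_iff_le_not_ge.1 hij
    hp i j (by by_contra hi; exact h.2 fun h' => absurd h' hi) fun hj => h.2 fun _ => hj
  have hbf : (b.toMatrix f).BlockTriangular p := by
    let := b.invertibleToMatrix f
    let := f.invertibleToMatrix b
    have : b.toMatrix f = (f.toMatrix b)⁻¹ :=
      (Matrix.inv_eq_left_inv (b.toMatrix_mul_toMatrix_flip f)).symm
    rw [this]
    exact Matrix.blockTriangular_inv_of_blockTriangular hfb
  exact ⟨forward hbf, forward hfb⟩

theorem exists_basis_matrixRep_eq_triMat_div_mul {K 𝒜 V : Type*} [Field K] [Ring 𝒜] [Algebra K 𝒜]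
    [AddCommGroup V] [Module K V] [Module 𝒜 V] [IsScalarTower K 𝒜 V] {d : ℕ}
    (b : Module.Basis (Fin (d + 1)) K V) {r : ℕ → K} (hr : ∀ i, 1 ≤ i → i ≤ d → r i ≠ 0) :
    ∃ b' : Module.Basis (Fin (d + 1)) K V, ∀ (X : 𝒜) (lo di up : ℕ → K),
      matrixRep b X = triMat lo di up → matrixRep b' X = triMat (lo / r) di (up * r) := by
  have prod_ne_zero (i : ℕ) (hi : i ≤ d) : ∏ h ∈ Finset.range i, r (h + 1) ≠ 0 :=
    Finset.prod_ne_zero_iff.2 fun h hh => hr _ (by omega) (by have := Finset.mem_range.1 hh; omega)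
  refine ⟨b.unitsSMul fun i => Units.mk0 _ (prod_ne_zero i (by omega)),
    fun X lo di up hX => ?_⟩
  ext i j
  have hi := prod_ne_zero i (by omega)
  have hj := prod_ne_zero j (by omega)
  rw [matrixRep_unitsSMul, hX]
  simp only [triMat, Matrix.of_apply, Units.val_mk0, Pi.div_apply, Pi.mul_apply]
  split_ifs with hlo hdi hup
  · have := hr i (by omega) (by omega)
    rw [hlo, Finset.prod_range_succ, ← hlo]
    field_simp
  · rw [hdi]
    field_simp
  · rw [hup, Finset.prod_range_succ, ← hup]
    field_simp
  · rw [mul_zero, zero_mul]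

theorem seqNat_coe {M : Type*} [Zero M] {d : ℕ} (f : Fin (d + 1) → M) (i : Fin (d + 1)) :
    seqNat f i = f i := by
  rw [seqNat, dif_pos i.2]

theorem seqNat_rev {M : Type*} [Zero M] {d : ℕ} (f : Fin (d + 1) → M) {n : ℕ} (hn : n ≤ d) :
    seqNat (fun i => f i.rev) n = seqNat f (d - n) := by
  have h : d - n < d + 1 := by omega
  simp only [seqNat, dif_pos h, dif_pos (Nat.lt_succ_of_le hn)]
  congr 1
  ext
  simp only [Fin.val_rev]
  omega

theorem prod_range_sub_eq_prod_Ioc {M : Type*} [CommMonoid M] (F : ℕ → M) {d n : ℕ} (hn : n ≤ d) :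
    ∏ k ∈ Finset.range n, F (d - k) = ∏ k ∈ Finset.Ioc (d - n) d, F k := by
  refine Finset.prod_bij' (fun k _ => d - k) (fun k _ => d - k) ?_ ?_ ?_ ?_ fun _ _ => rfl <;>
    simp only [Finset.mem_range, Finset.mem_Ioc] <;> omega

/-- `e` is a basis of eigenvectors of `A`, with eigenvalues `θ`, and `E i` acts as the projection
onto the line of `e i` along the other basis vectors. -/
structure IsEigenbasis {K 𝒜 V ι : Type*} [Field K] [Ring 𝒜] [AddCommGroup V] [Module K V]
    [Module 𝒜 V] (A : 𝒜) (θ : ι → K) (E : ι → 𝒜) (e : Module.Basis ι K V) : Prop where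
  smul_eq : ∀ i, A • e i = θ i • e i
  proj_smul : ∀ i x, E i • x = e.repr x i • e i

theorem IsEigenbasis.rev {K 𝒜 V : Type*} [Field K] [Ring 𝒜] [AddCommGroup V] [Module K V]
    [Module 𝒜 V] {d : ℕ} {A : 𝒜} {θ : Fin (d + 1) → K} {E : Fin (d + 1) → 𝒜}
    {e : Module.Basis (Fin (d + 1)) K V} (h : IsEigenbasis A θ E e) :
    IsEigenbasis A (fun i => θ i.rev) (fun i => E i.rev) (e.reindex Fin.revPerm) where
  smul_eq i := by simpa using h.smul_eq i.rev
  proj_smul i x := by simpa using h.proj_smul i.rev x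

section Eigenbasis

variable {K 𝒜 V : Type*} [Field K] [Ring 𝒜] [Algebra K 𝒜] [AddCommGroup V] [Module K V]
  [Module 𝒜 V] [IsScalarTower K 𝒜 V]

theorem repr_aeval_smul {ι : Type*} {e : Module.Basis ι K V} {A : 𝒜} {θ : ι → K}
    (he : ∀ i, A • e i = θ i • e i) (p : K[X]) (x : V) (k : ι) :
    e.repr (aeval A p • x) k = p.eval (θ k) * e.repr x k := by
  have smul_basis (i : ι) : aeval A p • e i = p.eval (θ i) • e i := by
    have hi : (Algebra.lsmul K K V A).HasEigenvector (θ i) (e i) :=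
      Module.End.hasEigenvector_iff.2 ⟨Module.End.mem_eigenspace_iff.2 (he i), e.ne_zero i⟩
    rw [← Module.End.aeval_apply_of_hasEigenvector hi, aeval_algHom_apply, Algebra.lsmul_coe]
  have hcomp : e.coord k ∘ₗ Algebra.lsmul K K V (aeval A p) = p.eval (θ k) • e.coord k := by
    refine e.ext fun i => ?_
    by_cases hik : i = k
    · simp [smul_basis, hik]
    · simp [smul_basis, hik]
  exact LinearMap.congr_fun hcomp x

namespace IsEigenbasis

variable {ι : Type*} {A : 𝒜} {θ : ι → K} {E : ι → 𝒜} {e : Module.Basis ι K V}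

theorem unitsSMul (h : IsEigenbasis A θ E e) (c : ι → Kˣ) :
    IsEigenbasis A θ E (e.unitsSMul c) where
  smul_eq i := by
    rw [Module.Basis.unitsSMul_apply, Units.smul_def, smul_algebra_smul_comm, h.smul_eq, smul_comm]
  proj_smul i x := by
    rw [h.proj_smul, Module.Basis.repr_unitsSMul, Module.Basis.unitsSMul_apply, Units.smul_def,
      Units.smul_def, smul_smul, smul_eq_mul, mul_right_comm, Units.inv_mul, one_mul]

theorem mem_image_iff (h : IsEigenbasis A θ E e) {i : ι} {x : V} :
    x ∈ LeonardSystem.image (K := K) V (E i) ↔ ∃ c : K, c • e i = x := by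
  constructor
  · rintro ⟨y, rfl⟩
    exact ⟨_, (h.proj_smul i y).symm⟩
  · rintro ⟨c, rfl⟩
    exact ⟨c • e i, by simp [h.proj_smul]⟩

theorem mem_iSup_image_iff (h : IsEigenbasis A θ E e) [Finite ι] {p : ι → Prop} {x : V} :
    x ∈ (⨆ j, ⨆ _ : p j, LeonardSystem.image (K := K) V (E j)) ↔
      ∀ k, ¬ p k → e.repr x k = 0 := by
  constructor
  · intro hx k hk
    have hle : (⨆ j, ⨆ _ : p j, LeonardSystem.image (K := K) V (E j)) ≤
        LinearMap.ker (e.coord k) := by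
      refine iSup₂_le fun j hj y hy => ?_
      obtain ⟨c, rfl⟩ := h.mem_image_iff.1 hy
      have : j ≠ k := fun hjk => hk (hjk ▸ hj)
      simp [this]
    exact hle hx
  · intro hx
    cases nonempty_fintype ι
    rw [← e.sum_repr x]
    refine Submodule.sum_mem _ fun k _ => ?_
    by_cases hk : p k
    · exact Submodule.mem_iSup_of_mem k (Submodule.mem_iSup_of_mem hk
        (h.mem_image_iff.2 ⟨_, rfl⟩))
    · rw [hx k hk, zero_smul]
      exact Submodule.zero_mem _

theorem exists_apply_eq (h : IsEigenbasis A θ E e) {i : ι} {η : V} (hη : η ≠ 0)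
    (hi : η ∈ LeonardSystem.image (K := K) V (E i)) :
    ∃ e' : Module.Basis ι K V, IsEigenbasis A θ E e' ∧ e' i = η := by
  obtain ⟨c, rfl⟩ := h.mem_image_iff.1 hi
  have hc : c ≠ 0 := fun hc => hη (by rw [hc, zero_smul])
  exact ⟨_, h.unitsSMul fun _ => Units.mk0 c hc, by
    rw [Module.Basis.unitsSMul_apply, Units.smul_mk0]⟩

theorem matrixRep_apply_self [Fintype ι] [DecidableEq ι] (h : IsEigenbasis A θ E e) (B : 𝒜)
    (i : ι) :
    matrixRep e B i i = LinearMap.trace K V (Algebra.lsmul K K V (B * E i)) := by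
  rw [LinearMap.trace_eq_matrix_trace K e, Matrix.trace, Finset.sum_eq_single i]
  · simp [matrixRep_apply, LinearMap.toMatrix_apply, h.proj_smul]
  · intro j _ hj
    simp [LinearMap.toMatrix_apply, h.proj_smul, hj]
  · simp

theorem exists_repr_eq_one (h : IsEigenbasis A θ E e) {x : V} (hx : ∀ k, e.repr x k ≠ 0) :
    ∃ g : Module.Basis ι K V, IsEigenbasis A θ E g ∧ ∀ k, g.repr x k = 1 :=
  ⟨_, h.unitsSMul fun k => Units.mk0 _ (hx k), fun k => by
    rw [Module.Basis.repr_unitsSMul, Units.smul_def, Units.val_inv_eq_inv_val, Units.val_mk0,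
      smul_eq_mul, inv_mul_cancel₀ (hx k)]⟩

end IsEigenbasis

variable {d : ℕ} {A : 𝒜} {θ : Fin (d + 1) → K} {E : Fin (d + 1) → 𝒜}
  {e : Module.Basis (Fin (d + 1)) K V}

theorem IsPrimitiveIdempotents.exists_eigenvector_basis [FaithfulSMul 𝒜 V]
    (h : IsPrimitiveIdempotents A θ E) (hV : Module.finrank K V = d + 1) :
    ∃ e : Module.Basis (Fin (d + 1)) K V, ∀ i, A • e i = θ i • e i := by
  let T : Module.End K V := Algebra.lsmul K K V A
  have : FiniteDimensional K V := Module.finite_of_finrank_pos (by omega)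
  have hminpoly : minpoly K T = minpoly K A :=
    minpoly.algHom_eq (Algebra.lsmul K K V) (fun X Y hXY =>
      FaithfulSMul.eq_of_smul_eq_smul (LinearMap.congr_fun hXY)) A
  have exists_eigenvector (i : Fin (d + 1)) : ∃ x, T.HasEigenvector (θ i) x := by
    refine (Module.End.hasEigenvalue_of_isRoot ?_).exists_hasEigenvector
    rw [hminpoly]
    exact (h.isRoot_iff _).2 ⟨i, rfl⟩
  choose x hx using exists_eigenvector
  refine ⟨basisOfLinearIndependentOfCardEqFinrank
    (Module.End.eigenvectors_linearIndependent' T θ h.injective x hx) (by simp [hV]), fun i => ?_⟩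
  rw [coe_basisOfLinearIndependentOfCardEqFinrank]
  exact (hx i).apply_eq_smul

theorem IsPrimitiveIdempotents.exists_isEigenbasis [FaithfulSMul 𝒜 V]
    (h : IsPrimitiveIdempotents A θ E) (hV : Module.finrank K V = d + 1) :
    ∃ e : Module.Basis (Fin (d + 1)) K V, IsEigenbasis A θ E e := by
  obtain ⟨e, he⟩ := h.exists_eigenvector_basis hV
  refine ⟨e, he, fun i x => e.ext_elem fun k => ?_⟩
  rw [h.E_eq, repr_aeval_smul he, eval_prod]
  by_cases hik : i = k
  · subst hik
    rw [Finset.prod_eq_one, one_mul]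
    · simp
    · intro j hj
      have := sub_ne_zero.2 (h.injective.ne (Finset.ne_of_mem_erase hj).symm)
      simp [this]
  · rw [Finset.prod_eq_zero (Finset.mem_erase.2 ⟨Ne.symm hik, Finset.mem_univ k⟩) (by simp)]
    simp [hik]

namespace IsEigenbasis

theorem matrixRep_eq_triMat (h : IsEigenbasis A θ E e) :
    matrixRep e A = triMat 0 (seqNat θ) 0 := by
  ext i j
  rw [matrixRep_apply, h.smul_eq]
  by_cases hij : i = j
  · simp [triMat, hij, seqNat_coe]
  · have := Fin.val_ne_iff.2 hij
    simp [triMat, this, Ne.symm hij]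

theorem isIrredTridiagonal_matrixRep [FaithfulSMul 𝒜 V] (h : IsEigenbasis A θ E e) {B : 𝒜}
    (hfar : ∀ i j : Fin (d + 1), 1 < |(i : ℤ) - (j : ℤ)| → E i * B * E j = 0)
    (hnear : ∀ i j : Fin (d + 1), |(i : ℤ) - (j : ℤ)| = 1 → E i * B * E j ≠ 0) :
    IsIrredTridiagonal (matrixRep e B) := by
  have smul_eq (i j : Fin (d + 1)) (x : V) :
      (E i * B * E j) • x = e.repr x j • matrixRep e B i j • e i := by
    rw [mul_smul, mul_smul, h.proj_smul j, smul_algebra_smul_comm _ B,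
      smul_algebra_smul_comm _ (E i), h.proj_smul i, matrixRep_apply]
  refine fun i j => ⟨fun hij => ?_, fun hij h0 => hnear i j hij ?_⟩
  · have := smul_eq i j (e j)
    rw [hfar i j hij, zero_smul, Module.Basis.repr_self, Finsupp.single_eq_same, one_smul] at this
    exact (smul_eq_zero.1 this.symm).resolve_right (e.ne_zero i)
  · refine FaithfulSMul.eq_of_smul_eq_smul (α := V) fun x => ?_
    rw [smul_eq, h0, zero_smul, smul_zero, zero_smul]

end IsEigenbasis

end Eigenbasis

theorem exists_basis_of_repr_upperTriangular {K V ι : Type*} [Field K] [AddCommGroup V] [Module K V]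
    [Finite ι] [LinearOrder ι] (f : Module.Basis ι K V) {v : ι → V}
    (hv : ∀ i j, j < i → f.repr (v j) i = 0) (hdiag : ∀ i, f.repr (v i) i ≠ 0) :
    ∃ b : Module.Basis ι K V, ⇑b = v := by
  cases nonempty_fintype ι
  have hdet : IsUnit (f.det v) := by
    rw [Module.Basis.det_apply,
      Matrix.det_of_isUpperTriangular (M := f.toMatrix v) fun i j hij => hv i j hij]
    exact isUnit_iff_ne_zero.2 (Finset.prod_ne_zero_iff.2 fun i _ => hdiag i)
  obtain ⟨hli, hspan⟩ := (Module.Basis.is_basis_iff_det f).2 hdet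
  exact ⟨Module.Basis.mk hli hspan.ge, Module.Basis.coe_mk hli hspan.ge⟩

/-- `b i` lies in the intersection of the span of `f 0, …, f i` with that of `e i, …, e d`. -/
structure IsFlagIntersection {K V : Type*} [Field K] [AddCommGroup V] [Module K V] {d : ℕ}
    (e f b : Module.Basis (Fin (d + 1)) K V) : Prop where
  repr_low : ∀ i j, j < i → f.repr (b j) i = 0
  repr_high : ∀ i j, i < j → e.repr (b j) i = 0

theorem IsFlagIntersection.repr_eq_zero_of_ne {K V : Type*} [Field K] [AddCommGroup V] [Module K V]
    {d : ℕ} {e f b : Module.Basis (Fin (d + 1)) K V} (h : IsFlagIntersection e f b)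
    {i : Fin (d + 1)} {x : V} (hf : ∀ k, i < k → f.repr x k = 0)
    (he : ∀ k, k < i → e.repr x k = 0) {k : Fin (d + 1)} (hk : k ≠ i) : b.repr x k = 0 := by
  rcases lt_or_gt_of_ne hk with hki | hik
  · exact (repr_eq_zero_iff_of_blockTriangular e b (p := (· < i))
      (fun l m hl hm => h.repr_high l m (lt_of_lt_of_le hl (not_lt.1 hm))) x).1 he k hki
  · exact (repr_eq_zero_iff_of_blockTriangular f b (p := (i < ·))
      (fun l m hl hm => h.repr_low l m (lt_of_le_of_lt (not_lt.1 hm) hl)) x).1 hf k hik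

section Bidiagonal

variable {K 𝒜 V : Type*} [Field K] [Ring 𝒜] [Algebra K 𝒜] [AddCommGroup V] [Module K V]
  [Module 𝒜 V] [IsScalarTower K 𝒜 V] {d : ℕ} {b : Module.Basis (Fin (d + 1)) K V} {X : 𝒜}

theorem smul_zero_of_matrixRep_eq_triMat {di up : ℕ → K} (hb : matrixRep b X = triMat 0 di up) :
    X • b 0 = di 0 • b 0 := by
  refine b.ext_elem fun k => ?_
  rw [← matrixRep_apply, hb]
  by_cases hk : k = 0
  · simp [triMat, hk]
  · simp [triMat, hk]

theorem smul_succ_of_matrixRep_eq_triMat {di up : ℕ → K} (hb : matrixRep b X = triMat 0 di up)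
    (j : Fin d) : X • b j.succ = di (j + 1) • b j.succ + up (j + 1) • b j.castSucc := by
  refine b.ext_elem fun k => ?_
  rw [← matrixRep_apply, hb]
  simp only [triMat, Matrix.of_apply, map_add, map_smul, Module.Basis.repr_self, Finsupp.add_apply,
    Finsupp.smul_apply, Finsupp.single_apply, Pi.zero_apply, smul_eq_mul, Fin.ext_iff,
    Fin.val_succ, Fin.val_castSucc]
  grind

theorem smul_castSucc_of_matrixRep_eq_triMat {lo di : ℕ → K} (hb : matrixRep b X = triMat lo di 0)
    (j : Fin d) : X • b j.castSucc = di j • b j.castSucc + lo (j + 1) • b j.succ := by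
  refine b.ext_elem fun k => ?_
  rw [← matrixRep_apply, hb]
  simp only [triMat, Matrix.of_apply, map_add, map_smul, Module.Basis.repr_self, Finsupp.add_apply,
    Finsupp.smul_apply, Finsupp.single_apply, Pi.zero_apply, smul_eq_mul, Fin.ext_iff,
    Fin.val_succ, Fin.val_castSucc]
  grind

variable {e : Module.Basis (Fin (d + 1)) K V} {θ : Fin (d + 1) → K}

theorem repr_eq_zero_of_upperBidiagonal {up : ℕ → K} (hθ : Function.Injective θ)
    (he : ∀ i, X • e i = θ i • e i) (hb : matrixRep b X = triMat 0 (seqNat θ) up)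
    (k j : Fin (d + 1)) (hjk : j < k) : e.repr (b j) k = 0 := by
  have repr_smul (x : V) : e.repr (X • x) k = θ k * e.repr x k := by
    simpa using repr_aeval_smul he Polynomial.X x k
  have sub_mul_eq_zero {j : Fin (d + 1)} (hjk : j < k)
      (h : e.repr (X • b j) k = θ j * e.repr (b j) k) : e.repr (b j) k = 0 := by
    rw [repr_smul, ← sub_eq_zero, ← sub_mul] at h
    exact (mul_eq_zero.1 h).resolve_left (sub_ne_zero.2 (hθ.ne hjk.ne'))
  induction j using Fin.induction with
  | zero =>
    refine sub_mul_eq_zero hjk ?_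
    rw [smul_zero_of_matrixRep_eq_triMat hb, map_smul, Finsupp.smul_apply, smul_eq_mul,
      ← seqNat_coe θ 0, Fin.val_zero]
  | succ j ih =>
    refine sub_mul_eq_zero hjk ?_
    rw [smul_succ_of_matrixRep_eq_triMat hb, map_add, map_smul, map_smul, Finsupp.add_apply,
      Finsupp.smul_apply, Finsupp.smul_apply, ih (j.castSucc_lt_succ.trans hjk), smul_zero,
      add_zero, smul_eq_mul, ← Fin.val_succ, seqNat_coe]

theorem repr_eq_zero_of_lowerBidiagonal {lo : ℕ → K} (hθ : Function.Injective θ)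
    (he : ∀ i, X • e i = θ i • e i) (hb : matrixRep b X = triMat lo (seqNat θ) 0)
    (k j : Fin (d + 1)) (hkj : k < j) : e.repr (b j) k = 0 := by
  have hb' : matrixRep (b.reindex Fin.revPerm) X =
      triMat 0 (seqNat fun i => θ i.rev) fun i => lo (d - i + 1) := by
    rw [matrixRep_reindex_rev, hb, triMat_submatrix_rev]
    exact triMat_congr (fun _ _ _ => rfl) (fun i hi => (seqNat_rev θ hi).symm) fun _ _ _ => rfl
  simpa using repr_eq_zero_of_upperBidiagonal (e := e.reindex Fin.revPerm)
    (hθ.comp Fin.rev_injective) (fun i => by simpa using he i.rev) hb' k.rev j.rev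
    (Fin.rev_lt_rev.2 hkj)

end Bidiagonal

namespace LeonardSystem

variable {K 𝒜 V : Type*} [Field K] [Ring 𝒜] [Algebra K 𝒜] [AddCommGroup V] [Module K V]
  [Module 𝒜 V] [IsScalarTower K 𝒜 V] {d : ℕ}

/-- `b` is a basis for the split decomposition of `Φ`, normalised by
`(A - θᵢ) bᵢ = bᵢ₊₁`; the splitting parameters are `φ`. -/
structure IsSplitBasis (Φ : LeonardSystem K 𝒜 d) (φ : ℕ → K) (b : Module.Basis (Fin (d + 1)) K V) :
    Prop where
  matrixRep_A : matrixRep b Φ.A = triMat 1 (seqNat Φ.θ) 0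
  matrixRep_As : matrixRep b Φ.As = triMat 0 (seqNat Φ.θs) φ

namespace IsSplitBasis

variable {Φ : LeonardSystem K 𝒜 d} {φ : ℕ → K} {e f b : Module.Basis (Fin (d + 1)) K V}

theorem isFlagIntersection (h : IsSplitBasis Φ φ b) (he : IsEigenbasis Φ.A Φ.θ Φ.E e)
    (hf : IsEigenbasis Φ.As Φ.θs Φ.Es f) : IsFlagIntersection e f b where
  repr_low := repr_eq_zero_of_upperBidiagonal Φ.primAs.injective hf.smul_eq h.matrixRep_As
  repr_high := repr_eq_zero_of_lowerBidiagonal Φ.primA.injective he.smul_eq h.matrixRep_A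

theorem splitSpace_eq_span (h : IsSplitBasis Φ φ b) (he : IsEigenbasis Φ.A Φ.θ Φ.E e)
    (hf : IsEigenbasis Φ.As Φ.θs Φ.Es f) (i : Fin (d + 1)) : Φ.splitSpace V i = K ∙ b i := by
  have flag := h.isFlagIntersection he hf
  ext x
  rw [splitSpace, Submodule.mem_inf, hf.mem_iSup_image_iff, he.mem_iSup_image_iff,
    Submodule.mem_span_singleton]
  constructor
  · rintro ⟨hlow, hhigh⟩
    refine ⟨b.repr x i, b.ext_elem fun k => ?_⟩
    by_cases hk : k = i
    · simp [hk]
    · rw [flag.repr_eq_zero_of_ne (fun k hik => hlow k (not_le.2 hik))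
        (fun k hki => hhigh k (not_le.2 hki)) hk]
      simp [Ne.symm hk]
  · rintro ⟨c, rfl⟩
    exact ⟨fun k hk => by simp [flag.repr_low k i (not_le.1 hk)],
      fun k hk => by simp [flag.repr_high k i (not_le.1 hk)]⟩

theorem mul_smul_succ (h : IsSplitBasis Φ φ b) (i : Fin d) :
    ((Φ.A - algebraMap K 𝒜 (seqNat Φ.θ i)) * (Φ.As - algebraMap K 𝒜 (seqNat Φ.θs (i + 1)))) •
      b i.succ = φ (i + 1) • b i.succ := by
  rw [mul_smul, sub_smul Φ.As, algebraMap_smul, smul_succ_of_matrixRep_eq_triMat h.matrixRep_As,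
    add_sub_cancel_left, smul_algebra_smul_comm, sub_smul, algebraMap_smul,
    smul_castSucc_of_matrixRep_eq_triMat h.matrixRep_A, add_sub_cancel_left, Pi.one_apply, one_smul]

theorem firstSplit_eq [FaithfulSMul 𝒜 V] (h : IsSplitBasis Φ φ b) {i : ℕ} (hi : 1 ≤ i)
    (hid : i ≤ d) : Φ.firstSplit V i = φ i := by
  have hV : Module.finrank K V = d + 1 := by simp [Module.finrank_eq_card_basis b]
  obtain ⟨e, he⟩ := Φ.primA.exists_isEigenbasis hV
  obtain ⟨f, hf⟩ := Φ.primAs.exists_isEigenbasis hV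
  obtain ⟨i, rfl⟩ := Nat.exists_eq_succ_of_ne_zero (Nat.one_le_iff_ne_zero.1 hi)
  let j : Fin d := ⟨i, hid⟩
  have hspan : Φ.splitSpace V (i + 1) = K ∙ b j.succ := h.splitSpace_eq_span he hf j.succ
  have acts : ∃ c : K, ∀ u ∈ Φ.splitSpace V (i + 1), ((Φ.A - algebraMap K 𝒜 (seqNat Φ.θ i)) *
      (Φ.As - algebraMap K 𝒜 (seqNat Φ.θs (i + 1)))) • u = c • u := by
    refine ⟨φ (i + 1), fun u hu => ?_⟩
    obtain ⟨t, rfl⟩ := Submodule.mem_span_singleton.1 (hspan ▸ hu)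
    rw [smul_algebra_smul_comm, h.mul_smul_succ j, smul_comm]
  have := Classical.epsilon_spec acts (b j.succ) (hspan ▸ Submodule.mem_span_singleton_self _)
  rw [h.mul_smul_succ j] at this
  rw [firstSplit, if_pos ⟨hi, hid⟩]
  exact (smul_left_injective K (b.ne_zero j.succ) this).symm

end IsSplitBasis

theorem fromLow_zero (A : 𝒜) (θ : Fin (d + 1) → K) : fromLow A θ 0 = 1 := by
  rw [fromLow, Finset.prod_range_zero, map_one]

theorem fromLow_succ_smul (A : 𝒜) (θ : Fin (d + 1) → K) (n : ℕ) (x : V) :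
    fromLow A θ (n + 1) • x = A • fromLow A θ n • x - seqNat θ n • fromLow A θ n • x := by
  rw [fromLow, Finset.prod_range_succ, mul_comm, map_mul, mul_smul, map_sub, aeval_X, aeval_C,
    sub_smul, algebraMap_smul, fromLow]

theorem fromLow_rev (A : 𝒜) (θ : Fin (d + 1) → K) {n : ℕ} (hn : n ≤ d) :
    fromLow A (fun i => θ i.rev) n = fromHigh A θ (d - n) := by
  rw [fromLow, fromHigh, ← prod_range_sub_eq_prod_Ioc _ hn]
  congr 1
  refine Finset.prod_congr rfl fun k hk => ?_
  rw [seqNat_rev θ ((Finset.mem_range_le hk).trans hn)]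

theorem fromHigh_rev (A : 𝒜) (θ : Fin (d + 1) → K) {n : ℕ} (hn : n ≤ d) :
    fromHigh A (fun i => θ i.rev) n = fromLow A θ (d - n) := by
  have := fromLow_rev A (fun i => θ i.rev) (Nat.sub_le d n)
  simpa only [Fin.rev_rev, Nat.sub_sub_self hn] using this.symm

theorem repr_fromLow_smul {e : Module.Basis (Fin (d + 1)) K V} {A : 𝒜} {θ : Fin (d + 1) → K}
    (he : ∀ i, A • e i = θ i • e i) (n : ℕ) (x : V) (k : Fin (d + 1)) :
    e.repr (fromLow A θ n • x) k =
      (∏ h ∈ Finset.range n, (θ k - seqNat θ h)) * e.repr x k := by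
  rw [fromLow, repr_aeval_smul he, eval_prod]
  simp

/-- An irreducible tridiagonal `A` moves the support of a vector up by exactly one step. -/
theorem repr_fromLow_smul_zero {f : Module.Basis (Fin (d + 1)) K V} {A : 𝒜}
    (hA : IsIrredTridiagonal (matrixRep f A)) (θ : Fin (d + 1) → K) (n : ℕ) :
    (∀ k : Fin (d + 1), n < k → f.repr (fromLow A θ n • f 0) k = 0) ∧
      ∀ k : Fin (d + 1), n = k → f.repr (fromLow A θ n • f 0) k ≠ 0 := by
  induction n with
  | zero =>
    rw [fromLow_zero, one_smul]
    refine ⟨fun k hk => ?_, fun k hk => ?_⟩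
    · simp [Fin.ne_of_lt (show 0 < k from hk)]
    · simp [show k = 0 from Fin.ext hk.symm]
  | succ n ih =>
    have repr_succ (k : Fin (d + 1)) (hk : n < k) :
        f.repr (fromLow A θ (n + 1) • f 0) k =
          (matrixRep f A).mulVec (f.repr (fromLow A θ n • f 0)) k := by
      rw [fromLow_succ_smul, map_sub, Finsupp.sub_apply, repr_smul_eq_mulVec f A,
        map_smul f.repr (seqNat θ n), Finsupp.smul_apply, ih.1 k hk, smul_zero, sub_zero]
    refine ⟨fun k hk => ?_, fun k hk => ?_⟩
    · rw [repr_succ k (by omega), hA.mulVec_apply_eq (m := k), ih.1 k (by omega), mul_zero]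
      intro l _ hkl
      exact ih.1 l (by have := abs_le.1 hkl; omega)
    · let m : Fin (d + 1) := ⟨n, by omega⟩
      rw [repr_succ k (by omega), hA.mulVec_apply_eq (m := m)]
      · exact mul_ne_zero ((hA k m).2 (by simp [m, ← hk])) (ih.2 m rfl)
      · intro l hlm hkl
        have := Fin.val_ne_iff.2 hlm
        exact ih.1 l (by have := abs_le.1 hkl; simp only [m] at *; omega)

end LeonardSystem

namespace LeonardSystem

variable {K 𝒜 V : Type*} [Field K] [Ring 𝒜] [Algebra K 𝒜] [AddCommGroup V] [Module K V]
  [Module 𝒜 V] [IsScalarTower K 𝒜 V] {d : ℕ} {e f b : Module.Basis (Fin (d + 1)) K V}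
  {A B : 𝒜} {θ : Fin (d + 1) → K}

theorem exists_isFlagIntersection_eq_fromLow_smul (he : ∀ i, A • e i = θ i • e i)
    (hA : IsIrredTridiagonal (matrixRep f A)) :
    ∃ b, (∀ i : Fin (d + 1), b i = fromLow A θ i • f 0) ∧ IsFlagIntersection e f b := by
  have support := repr_fromLow_smul_zero hA θ
  obtain ⟨b, hb⟩ := exists_basis_of_repr_upperTriangular f
    (v := fun i : Fin (d + 1) => fromLow A θ i • f 0)
    (fun i j hji => (support j).1 i hji) fun i => (support i).2 i rfl
  refine ⟨b, congr_fun hb, fun i j hji => ?_, fun i j hij => ?_⟩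
  · rw [hb]
    exact (support j).1 i hji
  · rw [hb, repr_fromLow_smul he, Finset.prod_eq_zero (Finset.mem_range.2 hij), zero_mul]
    rw [seqNat_coe, sub_self]

theorem matrixRep_eq_triMat_of_eq_fromLow_smul (he : ∀ i, A • e i = θ i • e i) {x : V}
    (hb : ∀ i : Fin (d + 1), b i = fromLow A θ i • x) :
    matrixRep b A = triMat 1 (seqNat θ) 0 := by
  have smul_eq (j : Fin (d + 1)) : A • b j = seqNat θ j • b j + fromLow A θ (j + 1) • x := by
    rw [hb, fromLow_succ_smul, add_sub_cancel]
  have fromLow_last : fromLow A θ (d + 1) • x = 0 := by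
    refine e.ext_elem fun k => ?_
    rw [repr_fromLow_smul he, Finset.prod_eq_zero (Finset.mem_range.2 k.2)]
    · simp
    · rw [seqNat_coe, sub_self]
  ext k j
  rw [matrixRep_apply, smul_eq, map_add, map_smul, Finsupp.add_apply, Finsupp.smul_apply,
    b.repr_self, Finsupp.single_apply]
  obtain hj | rfl := (Fin.le_last j).lt_or_eq
  · rw [← hb ⟨j + 1, Nat.succ_lt_succ hj⟩, b.repr_self, Finsupp.single_apply]
    simp only [triMat, Matrix.of_apply, Fin.ext_iff, Pi.one_apply, Pi.zero_apply, smul_eq_mul]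
    grind
  · rw [Fin.val_last, fromLow_last]
    simp only [triMat, Matrix.of_apply, Fin.ext_iff, Pi.zero_apply, smul_eq_mul, map_zero,
      Finsupp.zero_apply, Fin.val_last]
    grind

theorem repr_smul_sub_smul_eq_zero_of_isFlagIntersection (h : IsFlagIntersection e f b)
    (hB : IsIrredTridiagonal (matrixRep e B)) (hf : ∀ i, B • f i = θ i • f i) (j k : Fin (d + 1))
    (hkj : (k : ℕ) + 1 ≠ j) : b.repr (B • b j - θ j • b j) k = 0 := by
  have repr_f (j k : Fin (d + 1)) (hjk : j ≤ k) : f.repr (B • b j - θ j • b j) k = 0 := by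
    have := repr_aeval_smul hf X (b j) k
    rw [aeval_X, eval_X] at this
    rw [map_sub, Finsupp.sub_apply, this, map_smul, Finsupp.smul_apply, smul_eq_mul]
    obtain rfl | hjk := hjk.eq_or_lt
    · rw [sub_self]
    · rw [h.repr_low k j hjk, mul_zero, mul_zero, sub_zero]
  have repr_e (j k : Fin (d + 1)) (hkj : (k : ℕ) + 1 < j) :
      e.repr (B • b j - θ j • b j) k = 0 := by
    rw [map_sub, Finsupp.sub_apply, repr_smul_eq_mulVec e B, hB.mulVec_apply_eq (m := k), map_smul,
      Finsupp.smul_apply, h.repr_high k j (by omega), mul_zero, smul_zero, sub_zero]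
    intro l _ hkl
    exact h.repr_high l j (by have := abs_le.1 hkl; omega)
  induction j using Fin.cases with
  | zero =>
    have : B • b 0 - θ 0 • b 0 = 0 := f.ext_elem fun l => by simpa using repr_f 0 l l.zero_le
    rw [this, map_zero, Finsupp.zero_apply]
  | succ j =>
    refine h.repr_eq_zero_of_ne (i := j.castSucc) (fun l hl => repr_f _ l ?_)
      (fun l hl => repr_e _ l ?_) ?_
    · exact Fin.castSucc_lt_iff_succ_le.1 hl
    · exact Nat.succ_lt_succ hl
    · exact fun hkj' => hkj (by simp [hkj'])

theorem exists_matrixRep_eq_triMat_of_isFlagIntersection (h : IsFlagIntersection e f b)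
    (hB : IsIrredTridiagonal (matrixRep e B)) (hf : ∀ i, B • f i = θ i • f i) :
    ∃ φ, matrixRep b B = triMat 0 (seqNat θ) φ := by
  have repr_b := repr_smul_sub_smul_eq_zero_of_isFlagIntersection h hB hf
  have matrixRep_eq (k j : Fin (d + 1)) : matrixRep b B k j =
      b.repr (B • b j - θ j • b j) k + θ j * b.repr (b j) k := by
    rw [matrixRep_apply, map_sub, Finsupp.sub_apply, map_smul b.repr (θ j), Finsupp.smul_apply,
      smul_eq_mul, sub_add_cancel]
  refine exists_eq_triMat_zero (fun i => ?_) fun i j hij hij' => ?_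
  · rw [matrixRep_eq, repr_b i i (by omega), zero_add, b.repr_self, Finsupp.single_eq_same,
      mul_one, seqNat_coe]
  · rw [matrixRep_eq, repr_b j i hij', zero_add, b.repr_self, Finsupp.single_eq_of_ne hij,
      mul_zero]

end LeonardSystem

namespace LeonardSystem

variable {K 𝒜 V : Type*} [Field K] [Ring 𝒜] [Algebra K 𝒜] [AddCommGroup V] [Module K V]
  [Module 𝒜 V] [IsScalarTower K 𝒜 V] {d : ℕ} {Φ : LeonardSystem K 𝒜 d}
  {e f b : Module.Basis (Fin (d + 1)) K V}

theorem isIrredTridiagonal_matrixRep_As [FaithfulSMul 𝒜 V] (he : IsEigenbasis Φ.A Φ.θ Φ.E e) :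
    IsIrredTridiagonal (matrixRep e Φ.As) :=
  he.isIrredTridiagonal_matrixRep Φ.E_far Φ.E_near

theorem isIrredTridiagonal_matrixRep_A [FaithfulSMul 𝒜 V] (hf : IsEigenbasis Φ.As Φ.θs Φ.Es f) :
    IsIrredTridiagonal (matrixRep f Φ.A) :=
  hf.isIrredTridiagonal_matrixRep Φ.Es_far Φ.Es_near

theorem exists_isSplitBasis [FaithfulSMul 𝒜 V] (hf : IsEigenbasis Φ.As Φ.θs Φ.Es f) :
    ∃ b, IsSplitBasis Φ (Φ.firstSplit V) b ∧
      ∀ i : Fin (d + 1), b i = fromLow Φ.A Φ.θ i • f 0 := by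
  obtain ⟨e, he⟩ := Φ.primA.exists_isEigenbasis (Module.finrank_eq_card_basis f |>.trans (by simp))
  obtain ⟨b, hb, flag⟩ := exists_isFlagIntersection_eq_fromLow_smul he.smul_eq
    (isIrredTridiagonal_matrixRep_A hf)
  obtain ⟨φ, hφ⟩ := exists_matrixRep_eq_triMat_of_isFlagIntersection flag
    (isIrredTridiagonal_matrixRep_As he) hf.smul_eq
  have split : IsSplitBasis Φ φ b := ⟨matrixRep_eq_triMat_of_eq_fromLow_smul he.smul_eq hb, hφ⟩
  refine ⟨b, ⟨split.matrixRep_A, hφ.trans ?_⟩, hb⟩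
  exact triMat_congr (fun _ _ _ => rfl) (fun _ _ => rfl)
    fun i hi hid => (split.firstSplit_eq hi hid).symm

theorem repr_ne_zero_of_eq_fromLow_smul {A : 𝒜} {θ : Fin (d + 1) → K}
    (he : ∀ i, A • e i = θ i • e i) {x : V}
    (hb : ∀ i : Fin (d + 1), b i = fromLow A θ i • x) (k : Fin (d + 1)) : e.repr x k ≠ 0 := by
  intro hk
  have : e.coord k = 0 := b.ext fun i => by
    rw [Module.Basis.coord_apply, hb, repr_fromLow_smul he, hk, mul_zero, LinearMap.zero_apply]
  have := LinearMap.congr_fun this (e k)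
  simp at this

end LeonardSystem

section ProdBelow

variable {K : Type*} [Field K] {d : ℕ} {θ : Fin (d + 1) → K} {i : ℕ}

theorem prodBelow_seqNat_ne_zero (hθ : Function.Injective θ) (hi : i ≤ d) :
    prodBelow (seqNat θ) i ≠ 0 := by
  refine Finset.prod_ne_zero_iff.2 fun h hh => sub_ne_zero.2 ?_
  have hhi := Finset.mem_range.1 hh
  rw [seqNat, seqNat, dif_pos (by omega), dif_pos (by omega)]
  exact hθ.ne (Fin.val_ne_iff.1 hhi.ne')

theorem prodBelow_seqNat_rev (θ : Fin (d + 1) → K) (hi : i ≤ d) :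
    prodBelow (seqNat fun j => θ j.rev) i = prodAbove d (seqNat θ) (d - i) := by
  rw [prodBelow, prodAbove, ← prod_range_sub_eq_prod_Ioc _ hi]
  refine Finset.prod_congr rfl fun k hk => ?_
  rw [seqNat_rev θ hi, seqNat_rev θ ((Finset.mem_range_le hk).trans hi)]

theorem prodAbove_seqNat_rev (θ : Fin (d + 1) → K) (hi : i ≤ d) :
    prodAbove d (seqNat fun j => θ j.rev) i = prodBelow (seqNat θ) (d - i) := by
  have := prodBelow_seqNat_rev (fun j => θ j.rev) (Nat.sub_le d i)
  simpa only [Fin.rev_rev, Nat.sub_sub_self hi] using this.symm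

end ProdBelow

namespace LeonardSystem

variable {K 𝒜 V : Type*} [Field K] [Ring 𝒜] [Algebra K 𝒜] [AddCommGroup V] [Module K V]
  [Module 𝒜 V] [IsScalarTower K 𝒜 V] [FaithfulSMul 𝒜 V] {d : ℕ} {Φ : LeonardSystem K 𝒜 d}
  {e f : Module.Basis (Fin (d + 1)) K V}

theorem exists_isEigenbasis_repr_eq_one (hf : IsEigenbasis Φ.As Φ.θs Φ.Es f) :
    ∃ e : Module.Basis (Fin (d + 1)) K V,
      IsEigenbasis Φ.A Φ.θ Φ.E e ∧ ∀ k, e.repr (f 0) k = 1 := by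
  obtain ⟨e, he⟩ := Φ.primA.exists_isEigenbasis (Module.finrank_eq_card_basis f |>.trans (by simp))
  obtain ⟨b, -, hb⟩ := exists_isSplitBasis hf
  exact he.exists_repr_eq_one (repr_ne_zero_of_eq_fromLow_smul he.smul_eq hb)

theorem matrixRep_As_castSucc_succ (he : IsEigenbasis Φ.A Φ.θ Φ.E e)
    (hf : IsEigenbasis Φ.As Φ.θs Φ.Es f) (hone : ∀ k, e.repr (f 0) k = 1) (j : Fin d) :
    matrixRep e Φ.As j.castSucc j.succ = Φ.firstSplit V (j + 1) *
      (prodBelow (seqNat Φ.θ) j / prodBelow (seqNat Φ.θ) (j + 1)) := by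
  obtain ⟨b, split, hb⟩ := exists_isSplitBasis hf
  have repr_self (k : Fin (d + 1)) : e.repr (b k) k = prodBelow (seqNat Φ.θ) k := by
    rw [hb, repr_fromLow_smul he.smul_eq, prodBelow, seqNat_coe, hone, mul_one]
  have repr_high {k l : Fin (d + 1)} (hkl : k < l) : e.repr (b l) k = 0 :=
    repr_eq_zero_of_lowerBidiagonal Φ.primA.injective he.smul_eq split.matrixRep_A k l hkl
  have hsucc := congr_arg (fun y => e.repr y j.castSucc)
    (smul_succ_of_matrixRep_eq_triMat split.matrixRep_As j)
  simp only [map_add, map_smul, Finsupp.add_apply, Finsupp.smul_apply, smul_eq_mul] at hsucc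
  rw [repr_high j.castSucc_lt_succ, mul_zero, zero_add, repr_smul_eq_mulVec,
    (isIrredTridiagonal_matrixRep_As he).mulVec_apply_eq (m := j.succ), repr_self, repr_self,
    Fin.val_succ, Fin.val_castSucc] at hsucc
  · rw [← mul_div_assoc, eq_div_iff (prodBelow_seqNat_ne_zero Φ.primA.injective j.2), hsucc]
  · intro l hl hjl
    refine repr_high ?_
    have := Fin.val_ne_iff.2 hl
    rw [abs_le] at hjl
    simp only [Fin.lt_def, Fin.val_succ, Fin.val_castSucc] at *
    omega

theorem firstSplit_ne_zero (hf : IsEigenbasis Φ.As Φ.θs Φ.Es f) {i : ℕ} (hi : 1 ≤ i)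
    (hid : i ≤ d) : Φ.firstSplit V i ≠ 0 := by
  obtain ⟨e, he, hone⟩ := exists_isEigenbasis_repr_eq_one hf
  obtain ⟨i, rfl⟩ := Nat.exists_eq_succ_of_ne_zero (Nat.one_le_iff_ne_zero.1 hi)
  let j : Fin d := ⟨i, hid⟩
  refine left_ne_zero_of_mul (b := prodBelow (seqNat Φ.θ) i / prodBelow (seqNat Φ.θ) (i + 1)) ?_
  rw [← matrixRep_As_castSucc_succ he hf hone j]
  exact (isIrredTridiagonal_matrixRep_As he _ _).2 (by simp)

theorem matrixRep_As_succ_castSucc (he : IsEigenbasis Φ.A Φ.θ Φ.E e)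
    (hf : IsEigenbasis Φ.As Φ.θs Φ.Es f) (hone : ∀ k, e.repr (f 0) k = 1) (j : Fin d) :
    matrixRep e Φ.As j.succ j.castSucc = Φ.secondSplit V (d - j) *
      (prodAbove d (seqNat Φ.θ) (j + 1) / prodAbove d (seqNat Φ.θ) j) := by
  have := matrixRep_As_castSucc_succ (Φ := Φ.secondInversion) he.rev hf
    (fun k => by simpa using hone k.rev) j.rev
  rw [secondInversion, matrixRep_reindex_rev, Matrix.submatrix_apply, Fin.rev_castSucc,
    Fin.rev_rev, Fin.rev_succ, Fin.rev_rev] at this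
  rw [this, prodBelow_seqNat_rev, prodBelow_seqNat_rev, secondSplit, secondInversion, Fin.val_rev]
  · congr <;> omega
  all_goals omega

theorem matrixRep_As_eq_triMat (he : IsEigenbasis Φ.A Φ.θ Φ.E e)
    (hf : IsEigenbasis Φ.As Φ.θs Φ.Es f) (hone : ∀ k, e.repr (f 0) k = 1) :
    matrixRep e Φ.As = triMat
      (fun i => Φ.secondSplit V (d - i + 1) *
        (prodAbove d (seqNat Φ.θ) i / prodAbove d (seqNat Φ.θ) (i - 1)))
      (seqNat fun i => LinearMap.trace K V (Algebra.lsmul K K V (Φ.As * Φ.E i)))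
      (fun i => Φ.firstSplit V i *
        (prodBelow (seqNat Φ.θ) (i - 1) / prodBelow (seqNat Φ.θ) i)) := by
  ext i j
  simp only [triMat, Matrix.of_apply]
  split_ifs with hlo hdi hup
  · obtain ⟨m, rfl, rfl⟩ : ∃ m : Fin d, i = m.succ ∧ j = m.castSucc :=
      ⟨⟨j, by omega⟩, Fin.ext hlo, rfl⟩
    rw [matrixRep_As_succ_castSucc he hf hone, Fin.val_succ, Nat.add_sub_cancel,
      show d - (m + 1) + 1 = d - m by omega]
  · rw [← Fin.ext hdi, seqNat_coe, he.matrixRep_apply_self]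
  · obtain ⟨m, rfl, rfl⟩ : ∃ m : Fin d, i = m.castSucc ∧ j = m.succ :=
      ⟨⟨i, by omega⟩, rfl, Fin.ext hup⟩
    rw [matrixRep_As_castSucc_succ he hf hone, Fin.val_succ, Nat.add_sub_cancel]
  · exact (isIrredTridiagonal_matrixRep_As he i j).1 (by rw [lt_abs]; omega)

end LeonardSystem

namespace LeonardSystem

section Relatives

variable {K 𝒜 : Type*} [Field K] [Ring 𝒜] [Algebra K 𝒜] {d : ℕ}

/-- The dual `(A*; E*₀, …, E*_d; A; E₀, …, E_d)` of `Φ`. -/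
def dual (Φ : LeonardSystem K 𝒜 d) : LeonardSystem K 𝒜 d where
  A := Φ.As
  E := Φ.Es
  As := Φ.A
  Es := Φ.E
  θ := Φ.θs
  θs := Φ.θ
  primA := Φ.primAs
  primAs := Φ.primA
  E_far := Φ.Es_far
  E_near := Φ.Es_near
  Es_far := Φ.E_far
  Es_near := Φ.E_near

/-- The first inversion `(A; E₀, …, E_d; A*; E*_d, …, E*₀)` of `Φ`. -/
def firstInversion (Φ : LeonardSystem K 𝒜 d) : LeonardSystem K 𝒜 d :=
  Φ.dual.secondInversion.dual

theorem secondInversion_secondInversion (Φ : LeonardSystem K 𝒜 d) :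
    Φ.secondInversion.secondInversion = Φ := by
  cases Φ
  simp only [secondInversion, Fin.rev_rev]

end Relatives

variable {K 𝒜 V : Type*} [Field K] [Ring 𝒜] [Algebra K 𝒜] [AddCommGroup V] [Module K V]
  [Module 𝒜 V] [IsScalarTower K 𝒜 V] {d : ℕ} {Φ : LeonardSystem K 𝒜 d}
  {f b : Module.Basis (Fin (d + 1)) K V}

/-- `A` and `A*` are self-adjoint for the bilinear form that makes the eigenvectors of `A*`
orthogonal, with norms that symmetrise `A`. -/
theorem exists_basis_matrixRep_eq_transpose [FaithfulSMul 𝒜 V]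
    (hf : IsEigenbasis Φ.As Φ.θs Φ.Es f) (b : Module.Basis (Fin (d + 1)) K V) :
    ∃ b' : Module.Basis (Fin (d + 1)) K V,
      matrixRep b' Φ.A = (matrixRep b Φ.A).transpose ∧
      matrixRep b' Φ.As = (matrixRep b Φ.As).transpose := by
  obtain ⟨k, hk, hsymm⟩ := (isIrredTridiagonal_matrixRep_A hf).exists_symmetrizer
  have nondegenerate : (Matrix.toBilin f (Matrix.diagonal k)).Nondegenerate :=
    Matrix.Nondegenerate.toBilin (Matrix.nondegenerate_of_det_ne_zero (by
      rw [Matrix.det_diagonal]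
      exact Finset.prod_ne_zero_iff.2 fun i _ => hk i)) f
  have hdiag (i j : Fin (d + 1)) :
      k i * matrixRep f Φ.As i j = k j * matrixRep f Φ.As j i := by
    rw [hf.matrixRep_eq_triMat]
    by_cases hij : i = j
    · rw [hij]
    · rw [isDiag_triMat _ hij, isDiag_triMat _ (Ne.symm hij), mul_zero, mul_zero]
  exact ⟨_, matrixRep_dualBasis _ nondegenerate b (toBilin_diagonal_smul_comm hsymm),
    matrixRep_dualBasis _ nondegenerate b (toBilin_diagonal_smul_comm hdiag)⟩

theorem IsSplitBasis.exists_isSplitBasis_dual [FaithfulSMul 𝒜 V] {φ : ℕ → K}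
    (h : IsSplitBasis Φ φ b) (hf : IsEigenbasis Φ.As Φ.θs Φ.Es f)
    (hφ : ∀ i, 1 ≤ i → i ≤ d → φ i ≠ 0) :
    ∃ b' : Module.Basis (Fin (d + 1)) K V, IsSplitBasis Φ.dual φ b' := by
  obtain ⟨b', hA, hAs⟩ := exists_basis_matrixRep_eq_transpose hf b
  rw [h.matrixRep_A, triMat_transpose] at hA
  rw [h.matrixRep_As, triMat_transpose] at hAs
  obtain ⟨b'', hb''⟩ := exists_basis_matrixRep_eq_triMat_div_mul (𝒜 := 𝒜) b' hφ
  refine ⟨b'', (hb'' _ _ _ _ hAs).trans ?_, (hb'' _ _ _ _ hA).trans ?_⟩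
  · exact triMat_congr (fun i hi hid => div_self (hφ i hi hid)) (fun _ _ => rfl)
      fun _ _ _ => zero_mul _
  · exact triMat_congr (fun _ _ _ => zero_div _) (fun _ _ => rfl) fun _ _ _ => one_mul _

theorem firstSplit_dual [FaithfulSMul 𝒜 V] (hf : IsEigenbasis Φ.As Φ.θs Φ.Es f) {i : ℕ}
    (hi : 1 ≤ i) (hid : i ≤ d) : Φ.dual.firstSplit V i = Φ.firstSplit V i := by
  obtain ⟨b, split, -⟩ := exists_isSplitBasis hf
  obtain ⟨b', split'⟩ := split.exists_isSplitBasis_dual hf fun _ => firstSplit_ne_zero hf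
  exact split'.firstSplit_eq hi hid

theorem firstSplit_firstInversion [FaithfulSMul 𝒜 V] (hf : IsEigenbasis Φ.As Φ.θs Φ.Es f)
    {i : ℕ} (hi : 1 ≤ i) (hid : i ≤ d) :
    Φ.firstInversion.firstSplit V i = Φ.secondSplit V (d - i + 1) := by
  obtain ⟨b, split, -⟩ := exists_isSplitBasis (Φ := Φ.secondInversion) hf
  obtain ⟨b', hA, hAs⟩ := exists_basis_matrixRep_eq_transpose hf b
  have hA' : matrixRep b' Φ.A = triMat 0 (seqNat fun i => Φ.θ i.rev) 1 :=
    (hA.trans (congr_arg _ split.matrixRep_A)).trans (triMat_transpose ..)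
  have hAs' : matrixRep b' Φ.As = triMat (Φ.secondSplit V) (seqNat Φ.θs) 0 :=
    (hAs.trans (congr_arg _ split.matrixRep_As)).trans (triMat_transpose ..)
  have split' : IsSplitBasis Φ.firstInversion (fun i => Φ.secondSplit V (d - i + 1))
      (b'.reindex Fin.revPerm) := by
    constructor
    · refine (matrixRep_reindex_rev b' Φ.A).trans ?_
      rw [hA', triMat_submatrix_rev]
      refine triMat_congr (fun _ _ _ => rfl) (fun i hi => ?_) fun _ _ _ => rfl
      rw [seqNat_rev Φ.θ (Nat.sub_le d i), Nat.sub_sub_self hi]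
      rfl
    · refine (matrixRep_reindex_rev b' Φ.As).trans ?_
      rw [hAs', triMat_submatrix_rev]
      exact triMat_congr (fun _ _ _ => rfl) (fun i hi => (seqNat_rev Φ.θs hi).symm) fun _ _ _ => rfl
  exact split'.firstSplit_eq hi hid

theorem secondSplit_dual [FaithfulSMul 𝒜 V] (hf : IsEigenbasis Φ.As Φ.θs Φ.Es f) {i : ℕ}
    (hi : 1 ≤ i) (hid : i ≤ d) : Φ.dual.secondSplit V i = Φ.secondSplit V (d - i + 1) := by
  obtain ⟨e, he⟩ := Φ.primA.exists_isEigenbasis (Module.finrank_eq_card_basis f |>.trans (by simp))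
  rw [← firstSplit_firstInversion hf hi hid]
  exact (firstSplit_dual (Φ := Φ.dual.secondInversion) he hi hid).symm

theorem secondSplit_secondInversion (Φ : LeonardSystem K 𝒜 d) :
    Φ.secondInversion.secondSplit V = Φ.firstSplit V := by
  ext i
  rw [secondSplit, secondInversion_secondInversion]

end LeonardSystem

section SimpleModule

variable {K 𝒜 V ι : Type*} [Field K] [Ring 𝒜] [Algebra K 𝒜] [AddCommGroup V] [Module K V]
  [Module 𝒜 V] [Fintype ι] [DecidableEq ι]

theorem injective_of_map_mulVec {σ : 𝒜 ≃ₐ[K] Matrix ι ι K} {T : (ι → K) →ₗ[K] V} (hT : T ≠ 0)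
    (hσ : ∀ X c, T ((σ X).mulVec c) = X • T c) : Function.Injective T := by
  rw [← LinearMap.ker_eq_bot, LinearMap.ker_eq_bot']
  intro c hc
  by_contra! hc0
  obtain ⟨k, hk⟩ := Function.ne_iff.1 hc0
  refine hT (LinearMap.pi_ext' fun i => LinearMap.ext_ring ?_)
  have := hσ (σ.symm (Matrix.single i k 1)) c
  rw [σ.apply_symm_apply, hc, smul_zero, Matrix.single_mulVec, one_mul, ← mul_one (c k),
    ← smul_eq_mul] at this
  change T (Pi.single i (c k • 1)) = 0 at this
  rw [Pi.single_smul, map_smul] at this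
  exact (smul_eq_zero.1 this).resolve_left hk

theorem surjective_of_map_mulVec [IsSimpleModule 𝒜 V] {σ : 𝒜 ≃ₐ[K] Matrix ι ι K}
    {T : (ι → K) →ₗ[K] V} (hT : T ≠ 0) (hσ : ∀ X c, T ((σ X).mulVec c) = X • T c) :
    Function.Surjective T := by
  let N : Submodule 𝒜 V :=
    { (LinearMap.range T).toAddSubmonoid with
      smul_mem' := by
        rintro X _ ⟨c, rfl⟩
        exact ⟨(σ X).mulVec c, hσ X c⟩ }
  have hN : N = ⊤ := by
    refine (eq_bot_or_eq_top N).resolve_left fun h => hT (LinearMap.ext fun c => ?_)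
    have : T c ∈ N := ⟨c, rfl⟩
    rwa [h, Submodule.mem_bot] at this
  intro x
  have : x ∈ N := hN ▸ Submodule.mem_top
  exact this

variable [IsScalarTower K 𝒜 V]

theorem exists_linearMap_ne_zero_map_mulVec [Nontrivial V] (σ : 𝒜 ≃ₐ[K] Matrix ι ι K) :
    ∃ T : (ι → K) →ₗ[K] V, T ≠ 0 ∧ ∀ X c, T ((σ X).mulVec c) = X • T c := by
  obtain ⟨x, hx⟩ := exists_ne (0 : V)
  have one_eq_sum : 1 = ∑ i, σ.symm (Matrix.single i i 1) := by
    rw [← map_sum, Matrix.sum_single_one, map_one]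
  obtain ⟨i, hi⟩ : ∃ i, σ.symm (Matrix.single i i 1) • x ≠ 0 := by
    by_contra! h
    apply hx
    rw [← one_smul 𝒜 x, one_eq_sum, Finset.sum_smul]
    exact Finset.sum_eq_zero fun i _ => h i
  let T : (ι → K) →ₗ[K] V :=
    { toFun := fun c => σ.symm (Matrix.vecMulVec c (Pi.single i 1)) • x
      map_add' := fun c c' => by rw [Matrix.add_vecMulVec, map_add, add_smul]
      map_smul' := fun t c => by
        rw [Matrix.smul_vecMulVec, map_smul, smul_assoc, RingHom.id_apply] }
  refine ⟨T, fun hT => hi ?_, fun X c => ?_⟩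
  · simpa [T, ← Matrix.single_eq_single_vecMulVec_single] using
      LinearMap.congr_fun hT (Pi.single i 1)
  · change σ.symm _ • x = X • σ.symm _ • x
    rw [← Matrix.mul_vecMulVec, map_mul, σ.symm_apply_apply, mul_smul]

variable (V) [IsSimpleModule 𝒜 V]

theorem exists_basis_matrixRep_eq_algEquiv (σ : 𝒜 ≃ₐ[K] Matrix ι ι K) :
    ∃ b : Module.Basis ι K V, ∀ X : 𝒜, matrixRep b X = σ X := by
  have : Nontrivial V := IsSimpleModule.nontrivial 𝒜 V
  obtain ⟨T, hT, hσ⟩ := exists_linearMap_ne_zero_map_mulVec (V := V) σ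
  let Te := LinearEquiv.ofBijective T
    ⟨injective_of_map_mulVec hT hσ, surjective_of_map_mulVec hT hσ⟩
  refine ⟨Module.Basis.ofEquivFun Te.symm, fun X => ?_⟩
  ext i j
  have smul_basis : X • Te (Pi.single j 1) = Te ((σ X).mulVec (Pi.single j 1)) := (hσ X _).symm
  rw [matrixRep_apply, Module.Basis.coe_ofEquivFun, LinearEquiv.symm_symm, smul_basis,
    Module.Basis.ofEquivFun_repr_apply, LinearEquiv.symm_apply_apply, Matrix.mulVec_single_one,
    Matrix.col_apply]

theorem trace_algEquiv (σ : 𝒜 ≃ₐ[K] Matrix ι ι K) (X : 𝒜) :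
    (σ X).trace = LinearMap.trace K V (Algebra.lsmul K K V X) := by
  obtain ⟨b, hb⟩ := exists_basis_matrixRep_eq_algEquiv V σ
  rw [← hb, LinearMap.trace_eq_matrix_trace K b, matrixRep]

theorem finrank_eq_card_of_algEquiv (σ : 𝒜 ≃ₐ[K] Matrix ι ι K) :
    Module.finrank K V = Fintype.card ι := by
  obtain ⟨b, -⟩ := exists_basis_matrixRep_eq_algEquiv V σ
  exact Module.finrank_eq_card_basis b

theorem faithfulSMul_of_algEquiv (σ : 𝒜 ≃ₐ[K] Matrix ι ι K) : FaithfulSMul 𝒜 V where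
  eq_of_smul_eq_smul {X Y} hXY := by
    obtain ⟨b, hb⟩ := exists_basis_matrixRep_eq_algEquiv V σ
    apply σ.injective
    ext i j
    rw [← hb, ← hb, matrixRep_apply, matrixRep_apply, hXY]

end SimpleModule

/-- Exchanges `0` with `0*` and `d` with `d*`: the relabelling that corresponds to the dual of a
Leonard system. -/
def Omega4.dual : Omega4 → Omega4
  | .z0 => .s0
  | .zd => .sd
  | .s0 => .z0
  | .sd => .zd

/-- Exchanges `0` with `d`: the relabelling that corresponds to the second inversion of a Leonard
system. -/
def Omega4.invert : Omega4 → Omega4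
  | .z0 => .zd
  | .zd => .z0
  | .s0 => .s0
  | .sd => .sd

theorem Omega4.dual_injective : Function.Injective Omega4.dual := by
  rintro (_ | _ | _ | _) (_ | _ | _ | _) <;> simp [dual]

theorem Omega4.invert_injective : Function.Injective Omega4.invert := by
  rintro (_ | _ | _ | _) (_ | _ | _ | _) <;> simp [invert]

theorem Omega4.starred_dual (w : Omega4) : w.dual.Starred ↔ ¬ w.Starred := by
  cases w <;> simp [dual, Starred]

theorem Omega4.starred_invert (w : Omega4) : w.invert.Starred ↔ w.Starred := by
  cases w <;> simp [invert, Starred]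

namespace LeonardSystem

variable {K 𝒜 V : Type*} [Field K] [Ring 𝒜] [Algebra K 𝒜] [AddCommGroup V] [Module 𝒜 V]
  {d : ℕ}

theorem basisVec_dual (Φ : LeonardSystem K 𝒜 d) (η : Omega4 → V) (w x y z : Omega4) (i : ℕ) :
    Φ.dual.basisVec (η ∘ Omega4.dual) w.dual x.dual y.dual z.dual i = Φ.basisVec η w x y z i := by
  cases w <;> cases x <;> cases y <;> cases z <;> rfl

theorem basisVec_secondInversion (Φ : LeonardSystem K 𝒜 d) (η : Omega4 → V) (w x y z : Omega4)
    {i : ℕ} (hi : i ≤ d) :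
    Φ.secondInversion.basisVec (η ∘ Omega4.invert) w.invert x.invert y.invert z.invert i =
      Φ.basisVec η w x y z i := by
  cases w <;> cases x <;> cases y <;> cases z <;>
    simp [basisVec, Omega4.invert, secondInversion, fromLow_rev, fromHigh_rev, seqNat_rev,
      Nat.sub_sub_self, hi]

variable [Module K V] [IsScalarTower K 𝒜 V]

variable (V) in
/-- The matrices that the tables give for the ordering `wxyz`. -/
def tableMatrices (Φ : LeonardSystem K 𝒜 d)
    (σ : 𝒜 ≃ₐ[K] Matrix (Fin (d + 1)) (Fin (d + 1)) K) (w x y z : Omega4) :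
    Matrix (Fin (d + 1)) (Fin (d + 1)) K × Matrix (Fin (d + 1)) (Fin (d + 1)) K :=
  matrixTable d (seqNat Φ.θ) (seqNat Φ.θs) (Φ.a σ) (Φ.as σ) (Φ.firstSplit V) (Φ.secondSplit V)
    w x y z

theorem tableMatrices_secondInversion (Φ : LeonardSystem K 𝒜 d)
    (σ : 𝒜 ≃ₐ[K] Matrix (Fin (d + 1)) (Fin (d + 1)) K) (w x y z : Omega4) :
    Φ.secondInversion.tableMatrices V σ w.invert x.invert y.invert z.invert =
      Φ.tableMatrices V σ w x y z := by
  have as_rev {n : ℕ} (hn : n ≤ d) : Φ.secondInversion.as σ n = Φ.as σ (d - n) := by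
    simp only [as, secondInversion, seqNat_rev Φ.E hn]
  have firstSplit_eq : Φ.secondInversion.firstSplit V = Φ.secondSplit V := rfl
  have θs_eq : Φ.secondInversion.θs = Φ.θs := rfl
  have a_eq : Φ.secondInversion.a σ = Φ.a σ := rfl
  have θ_rev {n : ℕ} (hn : n ≤ d) : seqNat Φ.secondInversion.θ n = seqNat Φ.θ (d - n) :=
    seqNat_rev Φ.θ hn
  have below_rev {n : ℕ} (hn : n ≤ d) :
    prodBelow (seqNat Φ.secondInversion.θ) n = prodAbove d (seqNat Φ.θ) (d - n) :=
    prodBelow_seqNat_rev Φ.θ hn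
  have above_rev {n : ℕ} (hn : n ≤ d) :
    prodAbove d (seqNat Φ.secondInversion.θ) n = prodBelow (seqNat Φ.θ) (d - n) :=
    prodAbove_seqNat_rev Φ.θ hn
  rw [tableMatrices, tableMatrices, secondSplit_secondInversion, firstSplit_eq, θs_eq, a_eq]
  generalize seqNat Φ.secondInversion.θ = θ' at *
  generalize Φ.secondInversion.as σ = as' at *
  cases w <;> cases x <;> cases y <;> cases z <;>
    simp only [Omega4.invert, matrixTable] <;>
    refine congr_arg₂ Prod.mk (triMat_congr ?_ ?_ ?_) (triMat_congr ?_ ?_ ?_) <;> grind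

end LeonardSystem

/-- The shapes that the tables give for the matrices `M`, `N` representing `A`, `A*` with respect
to `[wxyz]`. -/
def HasShape {K : Type*} [Zero K] {d : ℕ} (y z : Omega4)
    (M N : Matrix (Fin (d + 1)) (Fin (d + 1)) K) : Prop :=
  (¬ y.Starred → ¬ z.Starred → M.IsDiag ∧ IsIrredTridiagonal N) ∧
  (y.Starred → ¬ z.Starred → IsLowerBidiagonal M ∧ IsUpperBidiagonal N) ∧
  (¬ y.Starred → z.Starred → IsUpperBidiagonal M ∧ IsLowerBidiagonal N) ∧
  (y.Starred → z.Starred → IsIrredTridiagonal M ∧ N.IsDiag)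

theorem hasShape_dual {K : Type*} [Zero K] {d : ℕ} {y z : Omega4}
    {M N : Matrix (Fin (d + 1)) (Fin (d + 1)) K} :
    HasShape y.dual z.dual N M ↔ HasShape y z M N := by
  by_cases hy : y.Starred <;> by_cases hz : z.Starred <;>
    simp [HasShape, Omega4.starred_dual, hy, hz, and_comm]

theorem hasShape_invert {K : Type*} [Zero K] {d : ℕ} {y z : Omega4}
    {M N : Matrix (Fin (d + 1)) (Fin (d + 1)) K} :
    HasShape y.invert z.invert M N ↔ HasShape y z M N := by
  simp only [HasShape, Omega4.starred_invert]

namespace LeonardSystem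

variable {K 𝒜 V : Type*} [Field K] [Ring 𝒜] [Algebra K 𝒜] [AddCommGroup V] [Module K V]
  [Module 𝒜 V] [IsScalarTower K 𝒜 V] {d : ℕ} {Φ : LeonardSystem K 𝒜 d} {η : Omega4 → V}
  {σ : 𝒜 ≃ₐ[K] Matrix (Fin (d + 1)) (Fin (d + 1)) K} {f : Module.Basis (Fin (d + 1)) K V}
  {w x y z : Omega4}

/-- The vectors `η₀ ∈ E₀V`, `η_d ∈ E_dV`, `η*₀ ∈ E*₀V`, `η*_d ∈ E*_dV` are nonzero. -/
structure IsExtremalFamily (Φ : LeonardSystem K 𝒜 d) (η : Omega4 → V) : Prop where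
  ne_zero : ∀ w, η w ≠ 0
  mem_z0 : η .z0 ∈ image (K := K) V (Φ.E 0)
  mem_zd : η .zd ∈ image (K := K) V (Φ.E (Fin.last d))
  mem_s0 : η .s0 ∈ image (K := K) V (Φ.Es 0)
  mem_sd : η .sd ∈ image (K := K) V (Φ.Es (Fin.last d))

theorem IsExtremalFamily.dual (h : Φ.IsExtremalFamily η) :
    Φ.dual.IsExtremalFamily (η ∘ Omega4.dual) :=
  ⟨fun _ => h.ne_zero _, h.mem_s0, h.mem_sd, h.mem_z0, h.mem_zd⟩

theorem IsExtremalFamily.secondInversion (h : Φ.IsExtremalFamily η) :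
    Φ.secondInversion.IsExtremalFamily (η ∘ Omega4.invert) where
  ne_zero _ := h.ne_zero _
  mem_z0 := by simpa [LeonardSystem.secondInversion, Omega4.invert] using h.mem_zd
  mem_zd := by simpa [LeonardSystem.secondInversion, Omega4.invert] using h.mem_z0
  mem_s0 := h.mem_s0
  mem_sd := h.mem_sd

/-- The assertion of the theorem for the ordering `wxyz`. -/
def IsTableRow (Φ : LeonardSystem K 𝒜 d) (σ : 𝒜 ≃ₐ[K] Matrix (Fin (d + 1)) (Fin (d + 1)) K)
    (η : Omega4 → V) (w x y z : Omega4) : Prop :=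
  ∃ b : Module.Basis (Fin (d + 1)) K V,
    (∀ i : Fin (d + 1), b i = Φ.basisVec η w x y z i) ∧
    (matrixRep b Φ.A, matrixRep b Φ.As) = Φ.tableMatrices V σ w x y z ∧
    HasShape y z (matrixRep b Φ.A) (matrixRep b Φ.As)

theorem IsTableRow.of_secondInversion (h : Φ.secondInversion.IsTableRow σ (η ∘ Omega4.invert)
    w.invert x.invert y.invert z.invert) : Φ.IsTableRow σ η w x y z := by
  obtain ⟨b, hb, htable, hshape⟩ := h
  exact ⟨b, fun i => (hb i).trans (basisVec_secondInversion Φ η w x y z i.is_le),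
    htable.trans (tableMatrices_secondInversion Φ σ w x y z), hasShape_invert.1 hshape⟩

theorem tableMatrices_dual [FaithfulSMul 𝒜 V] (hf : IsEigenbasis Φ.As Φ.θs Φ.Es f)
    (σ : 𝒜 ≃ₐ[K] Matrix (Fin (d + 1)) (Fin (d + 1)) K) (w x y z : Omega4) :
    Φ.dual.tableMatrices V σ w.dual x.dual y.dual z.dual =
      (Φ.tableMatrices V σ w x y z).swap := by
  have firstSplit_eq {n : ℕ} : 1 ≤ n → n ≤ d → Φ.dual.firstSplit V n = Φ.firstSplit V n :=
    firstSplit_dual hf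
  have secondSplit_eq {n : ℕ} :
    1 ≤ n → n ≤ d → Φ.dual.secondSplit V n = Φ.secondSplit V (d - n + 1) := secondSplit_dual hf
  change matrixTable d (seqNat Φ.θs) (seqNat Φ.θ) (Φ.as σ) (Φ.a σ) (Φ.dual.firstSplit V)
    (Φ.dual.secondSplit V) w.dual x.dual y.dual z.dual = _
  rw [tableMatrices]
  cases w <;> cases x <;> cases y <;> cases z <;>
    simp only [Omega4.dual, matrixTable, Prod.swap] <;>
    refine congr_arg₂ Prod.mk (triMat_congr ?_ ?_ ?_) (triMat_congr ?_ ?_ ?_) <;> grind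

theorem IsTableRow.of_dual [FaithfulSMul 𝒜 V] (hf : IsEigenbasis Φ.As Φ.θs Φ.Es f)
    (h : Φ.dual.IsTableRow σ (η ∘ Omega4.dual) w.dual x.dual y.dual z.dual) :
    Φ.IsTableRow σ η w x y z := by
  obtain ⟨b, hb, htable, hshape⟩ := h
  refine ⟨b, fun i => (hb i).trans (basisVec_dual Φ η w x y z i), ?_, hasShape_dual.1 hshape⟩
  rw [tableMatrices_dual hf] at htable
  exact Prod.swap_injective htable

section BaseRows

variable [FaithfulSMul 𝒜 V] (hf : IsEigenbasis Φ.As Φ.θs Φ.Es f) (h0 : f 0 = η .s0)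
include hf h0

theorem isTableRow_sd_z0_s0_zd : Φ.IsTableRow σ η .sd .z0 .s0 .zd := by
  obtain ⟨b, split, hb⟩ := exists_isSplitBasis hf
  refine ⟨b, fun i => (hb i).trans (congr_arg _ h0),
    congr_arg₂ Prod.mk split.matrixRep_A split.matrixRep_As, ?_⟩
  rw [split.matrixRep_A, split.matrixRep_As]
  simp [HasShape, Omega4.Starred, isLowerBidiagonal_triMat, isUpperBidiagonal_triMat]

theorem isTableRow_sd_z0_zd_s0 : Φ.IsTableRow σ η .sd .z0 .zd .s0 := by
  obtain ⟨b, split, hb⟩ := exists_isSplitBasis hf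
  have hA : matrixRep (b.reindex Fin.revPerm) Φ.A =
      triMat 0 (fun i => seqNat Φ.θ (d - i)) 1 := by
    rw [matrixRep_reindex_rev, split.matrixRep_A, triMat_submatrix_rev]
    rfl
  have hAs : matrixRep (b.reindex Fin.revPerm) Φ.As =
      triMat (fun i => Φ.firstSplit V (d - i + 1)) (fun i => seqNat Φ.θs (d - i)) 0 := by
    rw [matrixRep_reindex_rev, split.matrixRep_As, triMat_submatrix_rev]
    rfl
  refine ⟨b.reindex Fin.revPerm, fun i => ?_, congr_arg₂ Prod.mk hA hAs, ?_⟩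
  · rw [Module.Basis.reindex_apply, Fin.revPerm_symm, Fin.revPerm_apply, hb, h0, Fin.val_rev,
      Nat.add_sub_add_right]
    rfl
  · rw [hA, hAs]
    simp [HasShape, Omega4.Starred, isLowerBidiagonal_triMat, isUpperBidiagonal_triMat]

theorem isTableRow_sd_s0_z0_zd
    (hσ : ∀ X, (σ X).trace = LinearMap.trace K V (Algebra.lsmul K K V X)) :
    Φ.IsTableRow σ η .sd .s0 .z0 .zd := by
  obtain ⟨e, he, hone⟩ := exists_isEigenbasis_repr_eq_one hf
  refine ⟨e, fun i => ?_, congr_arg₂ Prod.mk he.matrixRep_eq_triMat ?_, ?_⟩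
  · rw [basisVec, seqNat_coe, ← h0, he.proj_smul, hone, one_smul]
  · rw [matrixRep_As_eq_triMat he hf hone]
    refine triMat_congr (fun _ _ _ => rfl) (fun i hi => ?_) fun _ _ _ => rfl
    lift i to Fin (d + 1) using Nat.lt_succ_of_le hi
    rw [as, hσ, seqNat_coe, seqNat_coe]
  · have hdiag : (matrixRep e Φ.A).IsDiag := he.matrixRep_eq_triMat ▸ isDiag_triMat _
    simp [HasShape, Omega4.Starred, hdiag, isIrredTridiagonal_matrixRep_As he]

end BaseRows

variable [IsSimpleModule 𝒜 V]

theorem exists_isEigenbasis_As (Φ : LeonardSystem K 𝒜 d)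
    (σ : 𝒜 ≃ₐ[K] Matrix (Fin (d + 1)) (Fin (d + 1)) K) :
    ∃ f : Module.Basis (Fin (d + 1)) K V, IsEigenbasis Φ.As Φ.θs Φ.Es f := by
  have := faithfulSMul_of_algEquiv V σ
  exact Φ.primAs.exists_isEigenbasis
    ((finrank_eq_card_of_algEquiv V σ).trans (Fintype.card_fin _))

theorem IsExtremalFamily.isTableRow_sd (h : Φ.IsExtremalFamily η) (hg : [.sd, x, y, z].Nodup) :
    Φ.IsTableRow σ η .sd x y z := by
  have := faithfulSMul_of_algEquiv V σ
  obtain ⟨e, he⟩ := Φ.exists_isEigenbasis_As (V := V) σ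
  obtain ⟨f, hf, h0⟩ := he.exists_apply_eq (h.ne_zero _) h.mem_s0
  have hf' : IsEigenbasis Φ.secondInversion.As Φ.secondInversion.θs Φ.secondInversion.Es f := hf
  have h0' : f 0 = (η ∘ Omega4.invert) .s0 := h0
  cases x <;> cases y <;> cases z <;> simp at hg
  · exact isTableRow_sd_z0_zd_s0 hf h0
  · exact isTableRow_sd_z0_s0_zd hf h0
  · exact .of_secondInversion (isTableRow_sd_z0_zd_s0 hf' h0')
  · exact .of_secondInversion (isTableRow_sd_z0_s0_zd hf' h0')
  · exact isTableRow_sd_s0_z0_zd hf h0 (trace_algEquiv V σ)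
  · exact .of_secondInversion (isTableRow_sd_s0_z0_zd hf' h0' (trace_algEquiv V σ))

theorem IsExtremalFamily.isTableRow_zd (h : Φ.IsExtremalFamily η) (hg : [.zd, x, y, z].Nodup) :
    Φ.IsTableRow σ η .zd x y z := by
  have := faithfulSMul_of_algEquiv V σ
  obtain ⟨f, hf⟩ := Φ.exists_isEigenbasis_As (V := V) σ
  exact .of_dual hf (h.dual.isTableRow_sd (hg.map Omega4.dual_injective))

theorem IsExtremalFamily.isTableRow_z0 (h : Φ.IsExtremalFamily η) (hg : [.z0, x, y, z].Nodup) :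
    Φ.IsTableRow σ η .z0 x y z :=
  .of_secondInversion (h.secondInversion.isTableRow_zd (hg.map Omega4.invert_injective))

theorem IsExtremalFamily.isTableRow_s0 (h : Φ.IsExtremalFamily η) (hg : [.s0, x, y, z].Nodup) :
    Φ.IsTableRow σ η .s0 x y z := by
  have := faithfulSMul_of_algEquiv V σ
  obtain ⟨f, hf⟩ := Φ.exists_isEigenbasis_As (V := V) σ
  exact .of_dual hf (h.dual.isTableRow_z0 (hg.map Omega4.dual_injective))

theorem IsExtremalFamily.isTableRow (h : Φ.IsExtremalFamily η) (hg : [w, x, y, z].Nodup) :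
    Φ.IsTableRow σ η w x y z :=
  match w with
  | .z0 => h.isTableRow_z0 hg
  | .zd => h.isTableRow_zd hg
  | .s0 => h.isTableRow_s0 hg
  | .sd => h.isTableRow_sd hg

end LeonardSystem

end

theorem theorem11p2 {K 𝒜 V : Type*} [Field K] [Ring 𝒜] [Algebra K 𝒜] (d : ℕ)
    (σ : 𝒜 ≃ₐ[K] Matrix (Fin (d + 1)) (Fin (d + 1)) K)
    [AddCommGroup V] [Module K V] [Module 𝒜 V] [IsScalarTower K 𝒜 V] [IsSimpleModule 𝒜 V]
    (Φ : LeonardSystem K 𝒜 d) (η : Omega4 → V) (hη : ∀ w, η w ≠ 0)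
    (h0 : η .z0 ∈ LeonardSystem.image (K := K) V (Φ.E 0))
    (hd : η .zd ∈ LeonardSystem.image (K := K) V (Φ.E (Fin.last d)))
    (hs0 : η .s0 ∈ LeonardSystem.image (K := K) V (Φ.Es 0))
    (hsd : η .sd ∈ LeonardSystem.image (K := K) V (Φ.Es (Fin.last d)))
    (g : Fin 4 ≃ Omega4) :
    ∃ b : Module.Basis (Fin (d + 1)) K V,
      (∀ i, b i = Φ.basisVec η (g 0) (g 1) (g 2) (g 3) i) ∧
      ∃ Ag Asg : Matrix (Fin (d + 1)) (Fin (d + 1)) K,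
        Ag = LinearMap.toMatrix b b (Algebra.lsmul K K V Φ.A) ∧
        Asg = LinearMap.toMatrix b b (Algebra.lsmul K K V Φ.As) ∧
        (Ag, Asg) = LeonardSystem.matrixTable d (seqNat Φ.θ) (seqNat Φ.θs) (Φ.a σ) (Φ.as σ)
          (Φ.firstSplit V) (Φ.secondSplit V) (g 0) (g 1) (g 2) (g 3) ∧
        (¬ (g 2).Starred → ¬ (g 3).Starred → Ag.IsDiag ∧ IsIrredTridiagonal Asg) ∧
        ((g 2).Starred → ¬ (g 3).Starred → IsLowerBidiagonal Ag ∧ IsUpperBidiagonal Asg) ∧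
        (¬ (g 2).Starred → (g 3).Starred → IsUpperBidiagonal Ag ∧ IsLowerBidiagonal Asg) ∧
        ((g 2).Starred → (g 3).Starred → IsIrredTridiagonal Ag ∧ Asg.IsDiag) := by
  have extremal : Φ.IsExtremalFamily η := ⟨hη, h0, hd, hs0, hsd⟩
  have distinct : [g 0, g 1, g 2, g 3].Nodup := List.nodup_ofFn.2 g.injective
  obtain ⟨b, hb, htable, hshape⟩ := extremal.isTableRow (σ := σ) distinct
  exact ⟨b, hb, _, _, rfl, rfl, htable, hshape⟩
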